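/- In \textsc{Partitioned Dominating Set Reconfiguration} an instance $\mathcal A=(G,D_{\rm init},D_{\rm fin},k)$ consists of a finite simple graph $G=(V,E)$, a partition of $V$ into $k$ token sets $P_1,\dots,P_k$, and two dominating sets $D_{\rm init},D_{\rm fin}$ of $G$, each containing exactly one vertex (token) of every $P_i$; the parameter is $k$. A reconfiguration sequence of length $\ell$ is a sequence $D_{\rm init}=D_0,D_1,\dots,D_\ell=D_{\rm fin}$ of dominating sets of $G$, each containing exactly one vertex of every $P_i$, such that for each $j<\ell$ we have $D_{j+1}=(D_j\setminus\{v\})\cup\{w\}$ for some $v\in D_j$ and $w\notin D_j$ in the same token set; in the TS (token sliding) variant one also requires $vw\in E$, in the TJ (token jumping) variant one does not. The question is whether a reconfiguration sequence exists. A pl-reduction is a map $f$ between instances that preserves and reflects yes-instances, for which the new parameter is bounded by a computable function of the old parameter $k$, and which can be computed in space $O(h(k)+\log n)$ for some computable function $h$, where $n$ is the number of bits of the input. There exists a pl-reduction $f$ from \textsc{Partitioned TS-Dominating Set Reconfiguration} to \textsc{Partitioned TJ-Dominating Set Reconfiguration} such that for every instance $\mathcal A$ of the former and every integer $\ell\ge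 0$: (i) $\mathcal A$ admits a reconfiguration sequence of length at most $\ell$ if and only if $f(\mathcal A)$ admits a reconfiguration sequence of length at most $3\ell+1$; (ii) if $\mathcal A$ admits a reconfiguration sequence of length exactly $\ell$, then $f(\mathcal A)$ admits one of length exactly $3\ell+1$; (iii) the shortest reconfiguration sequence of $\mathcal A$ has length $\ell$ if and only if the shortest reconfiguration sequence of $f(\mathcal A)$ has length $3\ell+1$. -/

import Mathlib

/-! Random access machines, parameterized problems and parameterized log-space reductions -/

namespace RAM

/-- A state of a random access machine with `r` registers: the register contents and
what has been written so far on the write-only output tape. -/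
structure State (r : ℕ) where
  reg : Fin r → ℕ
  out : List Bool

/-- Elementary instructions. `d` is the target register, `a` and `b` are source registers. -/
inductive Instr (r : ℕ) : Type
  | const (d : Fin r) (c : ℕ)
  | copy (d a : Fin r)
  | add (d a b : Fin r)
  | sub (d a b : Fin r)
  | mul (d a b : Fin r)
  | div (d a b : Fin r)
  | read (d a : Fin r)
  | write (c : Bool)

/-- Store `c` in register `d`. -/
def State.store {r : ℕ} (s : State r) (d : Fin r) (c : ℕ) : State r :=
  ⟨Function.update s.reg d c, s.out⟩

/-- The effect of an instruction on input `x`. Subtraction is truncated, division rounds down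
(and gives `0` for divisor `0`). `read d a` puts the input bit at the position held by register
`a` into register `d`; positions beyond the end of the input give `2`. -/
def Instr.exec {r : ℕ} (x : List Bool) : Instr r → State r → State r
  | .const d c, s => s.store d c
  | .copy d a, s => s.store d (s.reg a)
  | .add d a b, s => s.store d (s.reg a + s.reg b)
  | .sub d a b, s => s.store d (s.reg a - s.reg b)
  | .mul d a b, s => s.store d (s.reg a * s.reg b)
  | .div d a b, s => s.store d (s.reg a / s.reg b)
  | .read d a, s => s.store d
      (match x[s.reg a]? with
        | some true => 1
        | some false => 0
        | none => 2)
  | .write c, s => ⟨s.reg, s.out ++ [c]⟩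

/-- Programs over finitely many registers, built from instructions by composition, branching
(`ite a p q` runs `p` if register `a` is nonzero, and `q` otherwise) and iteration
(`loop a p` repeats `p` as long as register `a` is nonzero). -/
inductive Prog (r : ℕ) : Type
  | instr (i : Instr r)
  | seq (p q : Prog r)
  | ite (a : Fin r) (p q : Prog r)
  | loop (a : Fin r) (p : Prog r)

/-- The space in use under the logarithmic cost criterion: the total number of bits of the
register contents. The read-only input and the write-only output are not charged. -/
def State.bits {r : ℕ} (s : State r) : ℕ := ∑ i, (s.reg i).size

/-- `Runs x S p s t`: on input `x`, program `p` started in state `s` halts in state `t`, and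
the space in use never exceeds `S` bits. The machine is deterministic. Since the number of
registers is fixed and each instruction is computable in linear space in the bit lengths of its
operands, space here and space of Turing machines with a read-only input tape and
a write-only output tape agree up to constant factors (and an additive `log` of the input
length, for the head position). -/
inductive Runs {r : ℕ} (x : List Bool) (S : ℕ) : Prog r → State r → State r → Prop
  | instr (i : Instr r) (s : State r) (h : s.bits ≤ S) (h' : (i.exec x s).bits ≤ S) :
      Runs x S (.instr i) s (i.exec x s)
  | seq {p q : Prog r} {s t u : State r} (h : Runs x S p s t) (h' : Runs x S q t u) :
      Runs x S (.seq p q) s u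
  | ite_pos {a : Fin r} {p q : Prog r} {s t : State r} (ha : s.reg a ≠ 0)
      (h : Runs x S p s t) : Runs x S (.ite a p q) s t
  | ite_neg {a : Fin r} {p q : Prog r} {s t : State r} (ha : s.reg a = 0)
      (h : Runs x S q s t) : Runs x S (.ite a p q) s t
  | loop_stop {a : Fin r} {p : Prog r} {s : State r} (ha : s.reg a = 0) (h : s.bits ≤ S) :
      Runs x S (.loop a p) s s
  | loop_step {a : Fin r} {p : Prog r} {s t u : State r} (ha : s.reg a ≠ 0)
      (h : Runs x S p s t) (h' : Runs x S (.loop a p) t u) : Runs x S (.loop a p) s u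

/-- On input `x`, started with all registers zero and empty output, the program `p` halts
with output `y`, using at most `S` bits of space. -/
def Prog.Outputs {r : ℕ} (p : Prog r) (x y : List Bool) (S : ℕ) : Prop :=
  ∃ t : State r, Runs x S p ⟨fun _ => 0, []⟩ t ∧ t.out = y

end RAM

/-- A parameterized problem: its instances, their encoding as bit strings, the parameter of an
instance, and the yes-instances. -/
structure ParamProblem where
  Inst : Type
  code : Inst → List Bool
  param : Inst → ℕ
  Yes : Inst → Prop

/-- `f` is a parameterized log-space reduction (pl-reduction) from `P` to `Q`: it preserves and
reflects yes-instances, the new parameter is bounded by a computable function of the old one,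
and `f` is computed by a machine in space `O(h(k) + log n)`, where `h` is computable, `k` is
the parameter and `n` is the number of bits of the input. -/
structure IsPLReduction (P Q : ParamProblem) (f : P.Inst → Q.Inst) : Prop where
  yes_iff : ∀ A : P.Inst, P.Yes A ↔ Q.Yes (f A)
  param_le : ∃ g : ℕ → ℕ, Computable g ∧ ∀ A : P.Inst, Q.param (f A) ≤ g (P.param A)
  space : ∃ (r : ℕ) (p : RAM.Prog r) (h : ℕ → ℕ) (C : ℕ), Computable h ∧
    ∀ A : P.Inst, p.Outputs (P.code A) (Q.code (f A))
      (C * (h (P.param A) + Nat.log 2 (P.code A).length))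

/-! Partitioned dominating set reconfiguration -/

/-- `D` is a dominating set of `G`. -/
def IsDominatingSet {n : ℕ} (G : SimpleGraph (Fin n)) (D : Finset (Fin n)) : Prop :=
  ∀ v, v ∈ D ∨ ∃ w ∈ D, G.Adj v w

/-- The admissible token placements when the token sets are the fibres `part ⁻¹' {i}`: the
dominating sets with exactly one vertex in every token set. -/
def IsTokenDominatingSet {n k : ℕ} (G : SimpleGraph (Fin n)) (part : Fin n → Fin k)
    (D : Finset (Fin n)) : Prop :=
  IsDominatingSet G D ∧ ∀ i : Fin k, ∃! v, v ∈ D ∧ part v = i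

/-- An instance of partitioned dominating set reconfiguration with `k` tokens: a finite graph
whose vertex set is partitioned into `k` token sets (`part v` is the index of the token set
that contains `v`), an initial and a final dominating set. -/
structure PartitionedDSInstance where
  n : ℕ
  k : ℕ
  G : SimpleGraph (Fin n)
  part : Fin n → Fin k
  Dinit : Finset (Fin n)
  Dfin : Finset (Fin n)
  valid_init : IsTokenDominatingSet G part Dinit
  valid_fin : IsTokenDominatingSet G part Dfin

/-- Token sliding and token jumping. -/
inductive TokenRule
  | TS
  | TJ

namespace PartitionedDSInstance

/-- One move: the token on `v` goes to an empty vertex `w` of the same token set; for token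
sliding, `v` and `w` have to be adjacent. -/
def Move (rule : TokenRule) (A : PartitionedDSInstance) (D D' : Finset (Fin A.n)) : Prop :=
  ∃ v ∈ D, ∃ w ∉ D, A.part v = A.part w ∧ (rule = .TS → A.G.Adj v w) ∧
    D' = insert w (D.erase v)

/-- `A` admits a reconfiguration sequence `D₀ = Dinit, D₁, …, D_ℓ = Dfin` of length (number of
moves) exactly `ℓ`. -/
def HasSeq (rule : TokenRule) (A : PartitionedDSInstance) (ℓ : ℕ) : Prop :=
  ∃ D : ℕ → Finset (Fin A.n), D 0 = A.Dinit ∧ D ℓ = A.Dfin ∧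
    (∀ j ≤ ℓ, IsTokenDominatingSet A.G A.part (D j)) ∧
    ∀ j < ℓ, A.Move rule (D j) (D (j + 1))

open Classical in
/-- The encoding of an instance as a bit string: `n` and `k` in unary, then, row by row, the
adjacency matrix and the incidence matrix of vertices and token sets, then the
characteristic vectors of the initial and the final dominating set. -/
noncomputable def code (A : PartitionedDSInstance) : List Bool :=
  List.replicate A.n true ++ [false] ++ List.replicate A.k true ++ [false] ++
  (List.finRange A.n).flatMap
    (fun u => (List.finRange A.n).map fun v => decide (A.G.Adj u v)) ++
  (List.finRange A.n).flatMap
    (fun v => (List.finRange A.k).map fun i => decide (A.part v = i)) ++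
  (List.finRange A.n).map (fun v => decide (v ∈ A.Dinit)) ++
  (List.finRange A.n).map (fun v => decide (v ∈ A.Dfin))

end PartitionedDSInstance

/-- Partitioned TS-dominating set reconfiguration and partitioned TJ-dominating set
reconfiguration, parameterized by the number of tokens. The question is whether there exists
a reconfiguration sequence from the initial to the final dominating set. -/
noncomputable def PartitionedDSR (rule : TokenRule) : ParamProblem where
  Inst := PartitionedDSInstance
  code := PartitionedDSInstance.code
  param A := A.k
  Yes A := ∃ ℓ, A.HasSeq rule ℓ

/-! The new instance has two copies `T` and `S` of the token sets of `A`, a control token whose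
positions name pairs of vertices, and one more token, which is forced to stay on `q`. The forcing
comes from padding vertices, whose only neighbour is `q`: without a token on `q`, two of them would
carry tokens of the same token set. The vertex `q` dominates everything except the constraints `X a
b` with `a` and `b` in one token set of `A`. The constraint `X a a` requires the `T`-tokens to
dominate `a` in `A.G`. For `a ≠ b`, the constraint `X a b` matters only if the tokens of this set
are on `T a` and `S b`; then only the control token can dominate it, and only if it names the edge
`ab`.

Hence the valid placements are the triples `(t, s, c)` of `Allowed`: `t` is a token dominating set,
`s` a transversal, and `c` names the edge between their tokens wherever `t` and `s` differ
(`Allowed.valid`, `exists_allowed`). As `c` names a single pair, the copies differ in at most one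
token set (`Allowed.exists_of_ne`).

A slide from `v` to `w` becomes three jumps: the control token goes to `(v, w)`, then the first copy
moves, then the second. A last jump takes the control token to a final value that names no pair,
which gives `3ℓ + 1` (`hasSeq_reduction`). Conversely, jumps may be wasted or occur in another
order, but a new slide always costs a control jump and a jump in each copy. The amortised bounds of
`Invariant` make this precise and yield `hasSeq_of_reduction`.

For the space bound, new vertices are numbered by three digits in base `n + 2`, so every bit of the
new code is an arithmetic expression in its indices and the input bits. Such expressions compile to
programs with a fixed number of registers, and all values stay polynomial in the input length, hence
have logarithmically many bits (`Gen.outputs`, `code_reduction`). -/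

/-! ### A small expression language for logarithmic space -/

namespace RAM

/-- The environment `v`, with a new variable `0` of value `a`. -/
def push (a : ℕ) (v : ℕ → ℕ) : ℕ → ℕ
  | 0 => a
  | j + 1 => v j

@[simp] lemma push_zero (a : ℕ) (v : ℕ → ℕ) : push a v 0 = a := rfl
@[simp] lemma push_succ (a : ℕ) (v : ℕ → ℕ) (j : ℕ) : push a v (j + 1) = v j := rfl

/-- The binary operations of the machine. -/
inductive Op
  | add | sub | mul | div

/-- The meaning of a binary operation. -/
def Op.eval : Op → ℕ → ℕ → ℕ
  | .add, a, b => a + b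
  | .sub, a, b => a - b
  | .mul, a, b => a * b
  | .div, a, b => a / b

/-- The instruction that performs a binary operation. -/
def Op.instr {r : ℕ} (d a b : Fin r) : Op → Instr r
  | .add => .add d a b
  | .sub => .sub d a b
  | .mul => .mul d a b
  | .div => .div d a b

/-- Arithmetic expressions over an input string, with variables given by de Bruijn indices.
`scan a` is the number of consecutive ones from position `a` on, and `sum a b` is the sum of `b`
over all values smaller than `a` of a new variable. -/
inductive Expr
  | var (j : ℕ)
  | const (c : ℕ)
  | op (o : Op) (a b : Expr)
  | read (a : Expr)
  | scan (a : Expr)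
  | sum (a b : Expr)

/-- The value stored by `Instr.read`. -/
def bitAt (x : List Bool) (p : ℕ) : ℕ :=
  match x[p]? with
  | some true => 1
  | some false => 0
  | none => 2

/-- The number of consecutive ones in `x` from position `p` on. -/
def onesFrom (x : List Bool) (p : ℕ) : ℕ := ((x.drop p).takeWhile id).length

/-- The value of an expression. -/
def Expr.eval (x : List Bool) : Expr → (ℕ → ℕ) → ℕ
  | .var j, v => v j
  | .const c, _ => c
  | .op o a b, v => o.eval (a.eval x v) (b.eval x v)
  | .read a, v => bitAt x (a.eval x v)
  | .scan a, v => onesFrom x (a.eval x v)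
  | .sum a b, v => ∑ i ∈ Finset.range (a.eval x v), b.eval x (push i v)

/-- Generators of bit strings. -/
inductive Gen
  | bit (a : Expr)
  | seq (g h : Gen)
  | iter (a : Expr) (g : Gen)

/-- The string produced by a generator. -/
def Gen.out (x : List Bool) : Gen → (ℕ → ℕ) → List Bool
  | .bit a, v => [decide (a.eval x v ≠ 0)]
  | .seq g h, v => g.out x v ++ h.out x v
  | .iter a g, v => (List.range (a.eval x v)).flatMap fun i => g.out x (push i v)

/-- Register number `d` of a machine with `r + 1` registers. -/
def rg (r d : ℕ) : Fin (r + 1) := Fin.ofNat (r + 1) d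

/-- The program that adds the constant `1` to register `d`, using register `c`. -/
def incr (r d c : ℕ) : Prog (r + 1) :=
  .seq (.instr (.const (rg r c) 1)) (.instr (.add (rg r d) (rg r d) (rg r c)))

/-- The program that subtracts `1` from register `d`, using register `c`. -/
def decr (r d c : ℕ) : Prog (r + 1) :=
  .seq (.instr (.const (rg r c) 1)) (.instr (.sub (rg r d) (rg r d) (rg r c)))

/-- The program that tests whether the input bit at the position in register `d` is a one. The
result is put into register `d + 1`, and `d + 2` is used as well. -/
def testBit (r d : ℕ) : Prog (r + 1) :=
  .seq (.instr (.read (rg r (d + 1)) (rg r d))) <|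
  .seq (.instr (.const (rg r (d + 2)) 2)) <|
  .seq (.instr (.sub (rg r (d + 2)) (rg r (d + 2)) (rg r (d + 1))))
    (.instr (.mul (rg r (d + 1)) (rg r (d + 1)) (rg r (d + 2))))

/-- The program that puts the value of an expression into register `d`, leaving the registers
below `d` unchanged. Variable `j` is expected in register `ρ j`. -/
def Expr.compile (r : ℕ) : Expr → (ℕ → ℕ) → ℕ → Prog (r + 1)
  | .var j, ρ, d => .instr (.copy (rg r d) (rg r (ρ j)))
  | .const c, _, d => .instr (.const (rg r d) c)
  | .op o a b, ρ, d => .seq (a.compile r ρ d) <| .seq (b.compile r ρ (d + 1)) <|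
      .instr (o.instr (rg r d) (rg r d) (rg r (d + 1)))
  | .read a, ρ, d => .seq (a.compile r ρ d) (.instr (.read (rg r d) (rg r d)))
  | .scan a, ρ, d => .seq (a.compile r ρ (d + 1)) <| .seq (.instr (.const (rg r d) 0)) <|
      .seq (testBit r (d + 1)) <| .loop (rg r (d + 2)) <|
      .seq (incr r d (d + 3)) <| .seq (incr r (d + 1) (d + 3)) (testBit r (d + 1))
  | .sum a b, ρ, d => .seq (a.compile r ρ (d + 2)) <| .seq (.instr (.const (rg r d) 0)) <|
      .seq (.instr (.const (rg r (d + 1)) 0)) <| .loop (rg r (d + 2)) <|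
      .seq (b.compile r (push (d + 1) ρ) (d + 3)) <|
      .seq (.instr (.add (rg r d) (rg r d) (rg r (d + 3)))) <|
      .seq (incr r (d + 1) (d + 3)) (decr r (d + 2) (d + 3))

/-- The program that writes the output of a generator. -/
def Gen.compile (r : ℕ) : Gen → (ℕ → ℕ) → ℕ → Prog (r + 1)
  | .bit a, ρ, d => .seq (a.compile r ρ d) <|
      .ite (rg r d) (.instr (.write true)) (.instr (.write false))
  | .seq g h, ρ, d => .seq (g.compile r ρ d) (h.compile r ρ d)
  | .iter a g, ρ, d => .seq (a.compile r ρ (d + 1)) <| .seq (.instr (.const (rg r d) 0)) <|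
      .loop (rg r (d + 1)) <| .seq (g.compile r (push d ρ) (d + 2)) <|
      .seq (incr r d (d + 2)) (decr r (d + 1) (d + 2))

/-- The number of registers needed for an expression. -/
def Expr.height : Expr → ℕ
  | .var _ => 0
  | .const _ => 0
  | .op _ a b => max a.height (b.height + 1)
  | .read a => a.height
  | .scan a => a.height + 3
  | .sum a b => max (a.height + 2) (b.height + 3)

/-- The number of registers needed for a generator. -/
def Gen.height : Gen → ℕ
  | .bit a => a.height
  | .seq g h => max g.height h.height
  | .iter a g => max (a.height + 1) (g.height + 2)

/-- All numbers that occur in the evaluation of an expression are at most `B`. -/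
def Expr.Fits (x : List Bool) (B : ℕ) : Expr → (ℕ → ℕ) → Prop
  | .var _, _ => True
  | .const c, _ => c ≤ B
  | .op o a b, v => a.Fits x B v ∧ b.Fits x B v ∧ o.eval (a.eval x v) (b.eval x v) ≤ B
  | .read a, v => a.Fits x B v
  | .scan a, v => a.Fits x B v ∧ a.eval x v + x.length ≤ B
  | .sum a b, v => a.Fits x B v ∧ (∀ i < a.eval x v, b.Fits x B (push i v)) ∧
      ∑ i ∈ Finset.range (a.eval x v), b.eval x (push i v) ≤ B

/-- All numbers that occur in the evaluation of a generator are at most `B`. -/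
def Gen.Fits (x : List Bool) (B : ℕ) : Gen → (ℕ → ℕ) → Prop
  | .bit a, v => a.Fits x B v
  | .seq g h, v => g.Fits x B v ∧ h.Fits x B v
  | .iter a g, v => a.Fits x B v ∧ ∀ i < a.eval x v, g.Fits x B (push i v)

/-- The machine state with register contents `env`. -/
def State.ofEnv (r : ℕ) (env : ℕ → ℕ) (out : List Bool) : State (r + 1) :=
  ⟨fun i => env i, out⟩

/-! ### Correctness of compiled programs under a bound on register values -/

section Semantics

variable {r : ℕ} {x : List Bool} {S B : ℕ} {env env' env'' : ℕ → ℕ} {out : List Bool}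

lemma State.ofEnv_reg {d : ℕ} (hd : d ≤ r) : (State.ofEnv r env out).reg (rg r d) = env d := by
  simp [State.ofEnv, rg, Nat.mod_eq_of_lt (Nat.lt_succ_of_le hd)]

lemma State.ofEnv_store {d : ℕ} (hd : d ≤ r) (c : ℕ) :
    (State.ofEnv r env out).store (rg r d) c = State.ofEnv r (Function.update env d c) out := by
  have h : (rg r d : ℕ) = d := by simp [rg, Nat.mod_eq_of_lt (Nat.lt_succ_of_le hd)]
  simp only [State.store, State.ofEnv, State.mk.injEq, and_true]
  funext i
  by_cases hi : i = rg r d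
  · subst hi; simp [h]
  · have : (i : ℕ) ≠ d := fun h' => hi (Fin.ext (h'.trans h.symm))
    simp [Function.update_of_ne hi, Function.update_of_ne this]

lemma State.bits_ofEnv_le (hS : (r + 1) * B.size ≤ S) (h : ∀ i, env i ≤ B) :
    (State.ofEnv r env out).bits ≤ S := by
  refine le_trans ?_ hS
  unfold State.bits
  refine (Finset.sum_le_card_nsmul Finset.univ
    (fun i => ((State.ofEnv r env out).reg i).size) B.size
    fun i _ => Nat.size_le_size (h i)).trans ?_
  simp

/-- The program `p` changes the register contents `env`, bounded by `B`, to `env'`, also bounded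
by `B`, and writes nothing. -/
def Exec (r : ℕ) (x : List Bool) (S B : ℕ) (p : Prog (r + 1)) (env env' : ℕ → ℕ) : Prop :=
  (∀ i, env' i ≤ B) ∧ ∀ out, Runs x S p (State.ofEnv r env out) (State.ofEnv r env' out)

lemma Exec.seq {p q : Prog (r + 1)} (hp : Exec r x S B p env env')
    (hq : Exec r x S B q env' env'') : Exec r x S B (.seq p q) env env'' :=
  ⟨hq.1, fun out => .seq (hp.2 out) (hq.2 out)⟩

lemma Exec.of_store (hS : (r + 1) * B.size ≤ S) (h : ∀ i, env i ≤ B) {i : Instr (r + 1)} {d c : ℕ}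
    (hd : d ≤ r) (hc : c ≤ B)
    (hi : ∀ out, i.exec x (State.ofEnv r env out) = (State.ofEnv r env out).store (rg r d) c) :
    Exec r x S B (.instr i) env (Function.update env d c) := by
  have h' : ∀ j, Function.update env d c j ≤ B := fun j => by
    by_cases hj : j = d
    · subst hj; simpa using hc
    · simpa [Function.update_of_ne hj] using h j
  refine ⟨h', fun out => ?_⟩
  have e := (hi out).trans (State.ofEnv_store hd c)
  rw [← e]
  exact .instr _ _ (State.bits_ofEnv_le hS h) (e ▸ State.bits_ofEnv_le hS h')

lemma exec_const (hS : (r + 1) * B.size ≤ S) (h : ∀ i, env i ≤ B) {d c : ℕ} (hd : d ≤ r)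
    (hc : c ≤ B) :
    Exec r x S B (.instr (.const (rg r d) c)) env (Function.update env d c) :=
  .of_store hS h hd hc fun _ => rfl

lemma exec_copy (hS : (r + 1) * B.size ≤ S) (h : ∀ i, env i ≤ B) {d a : ℕ} (hd : d ≤ r)
    (ha : a ≤ r) :
    Exec r x S B (.instr (.copy (rg r d) (rg r a))) env (Function.update env d (env a)) :=
  .of_store hS h hd (h a) fun _ => by simp only [Instr.exec, State.ofEnv_reg ha]

lemma exec_read (hS : (r + 1) * B.size ≤ S) (h : ∀ i, env i ≤ B) (hB : 2 ≤ B) {d a : ℕ}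
    (hd : d ≤ r) (ha : a ≤ r) :
    Exec r x S B (.instr (.read (rg r d) (rg r a))) env
      (Function.update env d (bitAt x (env a))) := by
  refine .of_store hS h hd ?_ fun _ => ?_
  · unfold bitAt; split <;> omega
  · simp only [Instr.exec, State.ofEnv_reg ha]
    rfl

lemma exec_op (hS : (r + 1) * B.size ≤ S) (h : ∀ i, env i ≤ B) (o : Op) {d a b : ℕ} (hd : d ≤ r)
    (ha : a ≤ r) (hb : b ≤ r) (hc : o.eval (env a) (env b) ≤ B) :
    Exec r x S B (.instr (o.instr (rg r d) (rg r a) (rg r b))) env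
      (Function.update env d (o.eval (env a) (env b))) :=
  .of_store hS h hd hc fun _ => by
    cases o <;> simp only [Op.instr, Instr.exec, State.ofEnv_reg ha, State.ofEnv_reg hb, Op.eval]

lemma exec_incr (hS : (r + 1) * B.size ≤ S) (h : ∀ i, env i ≤ B) {d c : ℕ} (hd : d ≤ r)
    (hc : c ≤ r) (hdc : d ≠ c) (hB : env d + 1 ≤ B) :
    Exec r x S B (incr r d c) env
      (Function.update (Function.update env c 1) d (env d + 1)) := by
  have h1 := exec_const (x := x) hS h hc (show 1 ≤ B by omega)
  refine h1.seq ?_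
  simpa [Op.eval, Op.instr, hdc] using exec_op (x := x) hS h1.1 .add hd hd hc
    (by simpa [Op.eval, hdc] using hB)

lemma exec_decr (hS : (r + 1) * B.size ≤ S) (h : ∀ i, env i ≤ B) {d c : ℕ} (hd : d ≤ r)
    (hc : c ≤ r) (hdc : d ≠ c) (hB : 1 ≤ B) :
    Exec r x S B (decr r d c) env
      (Function.update (Function.update env c 1) d (env d - 1)) := by
  have h1 := exec_const (x := x) hS h hc hB
  refine h1.seq ?_
  simpa [Op.eval, Op.instr, hdc] using exec_op (x := x) hS h1.1 .sub hd hd hc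
    (by have := h d; simp [Op.eval, hdc]; omega)

/-- Reading yields a value `b` among `0`, `1`, `2`, with `2` beyond the end of the input, and `b *
(2 - b)` is `1` only for `b = 1`. A scan therefore stops at the end of the input just as at a zero.
-/
lemma exec_testBit (hS : (r + 1) * B.size ≤ S) (h : ∀ i, env i ≤ B) (hB : 2 ≤ B) {d : ℕ}
    (hd : d + 2 ≤ r) :
    ∃ env', Exec r x S B (testBit r d) env env' ∧
      env' (d + 1) = (if x[env d]? = some true then 1 else 0) ∧ ∀ i ≤ d, env' i = env i := by
  have h1 := exec_read (x := x) hS h hB (show d + 1 ≤ r by omega) (show d ≤ r by omega)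
  have h2 := exec_const (x := x) hS h1.1 hd hB
  have h3 := exec_op (x := x) hS h2.1 .sub hd hd (show d + 1 ≤ r by omega)
    (by simp [Op.eval]; omega)
  have h4 := exec_op (x := x) hS h3.1 .mul (show d + 1 ≤ r by omega) (show d + 1 ≤ r by omega) hd
    (by
      simp only [Op.eval, Function.update_self, ne_eq, Nat.add_left_cancel_iff,
        OfNat.one_ne_ofNat, not_false_eq_true, Function.update_of_ne]
      unfold bitAt; split <;> omega)
  refine ⟨_, h1.seq (h2.seq (h3.seq h4)), ?_, fun i hi => ?_⟩
  · simp only [Op.eval, Function.update_self, ne_eq, Nat.add_left_cancel_iff,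
        OfNat.one_ne_ofNat, not_false_eq_true, Function.update_of_ne]
    unfold bitAt
    rcases hx : x[env d]? with _ | _ | _ <;> simp
  · rw [Function.update_of_ne (by omega), Function.update_of_ne (by omega),
      Function.update_of_ne (by omega), Function.update_of_ne (by omega)]

/-- A loop that is passed `N` times. -/
lemma runs_loop {a : Fin (r + 1)} {p : Prog (r + 1)} (N : ℕ) (Inv : ℕ → State (r + 1) → Prop)
    (hstep : ∀ i < N, ∀ s, Inv i s → s.reg a ≠ 0 ∧ ∃ t, Runs x S p s t ∧ Inv (i + 1) t)
    (hend : ∀ s, Inv N s → s.reg a = 0 ∧ s.bits ≤ S) {s : State (r + 1)} (hs : Inv 0 s) :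
    ∃ t, Runs x S (.loop a p) s t ∧ Inv N t := by
  -- Induction on the number of passes still to come, because a run of a loop unfolds from its first
  -- pass.
  have key : ∀ j ≤ N, ∀ s, Inv (N - j) s → ∃ t, Runs x S (.loop a p) s t ∧ Inv N t := by
    intro j
    induction j with
    | zero => exact fun _ s hs => ⟨s, Runs.loop_stop (hend s hs).1 (hend s hs).2, hs⟩
    | succ j ih =>
      intro hj s hs
      obtain ⟨h0, t, ht, hi⟩ := hstep (N - (j + 1)) (by omega) s hs
      rw [show N - (j + 1) + 1 = N - j by omega] at hi
      obtain ⟨u, hu, hN⟩ := ih (by omega) t hi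
      exact ⟨u, .loop_step h0 ht hu, hN⟩
  exact key N le_rfl s (by simpa using hs)

/-- A loop without output that is passed `N` times. -/
lemma exec_loop (hS : (r + 1) * B.size ≤ S) {a : ℕ} (ha : a ≤ r) {p : Prog (r + 1)} (N : ℕ)
    (Inv : ℕ → (ℕ → ℕ) → Prop)
    (hstep : ∀ i < N, ∀ e, (∀ j, e j ≤ B) → Inv i e →
      e a ≠ 0 ∧ ∃ e', Exec r x S B p e e' ∧ Inv (i + 1) e')
    (hend : ∀ e, Inv N e → e a = 0) (h : ∀ j, env j ≤ B) (hs : Inv 0 env) :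
    ∃ env', Exec r x S B (.loop (rg r a) p) env env' ∧ Inv N env' := by
  have key : ∀ j ≤ N, ∀ e, (∀ j, e j ≤ B) → Inv (N - j) e →
      ∃ e', Exec r x S B (.loop (rg r a) p) e e' ∧ Inv N e' := by
    intro j
    induction j with
    | zero =>
      refine fun _ e hb he => ⟨e, ⟨hb, fun out => Runs.loop_stop ?_ (State.bits_ofEnv_le hS hb)⟩, he⟩
      rw [State.ofEnv_reg ha, hend e he]
    | succ j ih =>
      intro hj e hb he
      obtain ⟨h0, e', he', hi⟩ := hstep (N - (j + 1)) (by omega) e hb he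
      rw [show N - (j + 1) + 1 = N - j by omega] at hi
      obtain ⟨e'', he'', hN⟩ := ih (by omega) e' he'.1 hi
      exact ⟨e'', ⟨he''.1, fun out => .loop_step (by rwa [State.ofEnv_reg ha]) (he'.2 out)
        (he''.2 out)⟩, hN⟩
  exact key N le_rfl env h (by simpa using hs)

lemma onesFrom_of_lt {p i : ℕ} (h : i < onesFrom x p) : x[p + i]? = some true := by
  unfold onesFrom at h
  have h1 := List.takeWhile_prefix (p := id) (l := x.drop p)
  have h2 := h1.getElem h
  have h3 : ((x.drop p).takeWhile id)[i] = true := by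
    have := List.mem_takeWhile_imp (List.getElem_mem h)
    simpa using this
  have h4 := h1.length_le
  rw [h3] at h2
  rw [← List.getElem?_drop, List.getElem?_eq_getElem (by omega), ← h2]

lemma onesFrom_stop (p : ℕ) : x[p + onesFrom x p]? ≠ some true := by
  unfold onesFrom
  rw [← List.getElem?_drop]
  induction x.drop p with
  | nil => simp
  | cons b l ih => cases b <;> simp_all

lemma onesFrom_le (p : ℕ) : onesFrom x p ≤ x.length := by
  unfold onesFrom
  refine (List.takeWhile_prefix _).length_le.trans ?_
  simp

/-- The registers serve as a stack: variables live below `d`, and a subprogram compiled at a higher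
level leaves everything below that level alone, so intermediate results survive. `Fits` keeps the
stored values below `B`, and `2 ≤ B` leaves room for the value read beyond the input. -/
theorem Expr.compile_exec (hS : (r + 1) * B.size ≤ S) (hB : 2 ≤ B) (e : Expr) :
    ∀ (ρ : ℕ → ℕ) (d : ℕ) (env v : ℕ → ℕ), (∀ j, ρ j < d) → (∀ j, env (ρ j) = v j) →
      d + e.height ≤ r → (∀ i, env i ≤ B) → e.Fits x B v →
      ∃ env', Exec r x S B (e.compile r ρ d) env env' ∧ env' d = e.eval x v ∧
        ∀ i < d, env' i = env i := by
  induction e with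
  | var j =>
    intro ρ d env v hρ hv hr hb hf
    simp only [Expr.height] at hr
    refine ⟨_, exec_copy hS hb (by omega) (by have := hρ j; omega), by simp [Expr.eval, hv], ?_⟩
    exact fun i hi => Function.update_of_ne (by omega) _ _
  | const c =>
    intro ρ d env v hρ hv hr hb hf
    simp only [Expr.height] at hr
    refine ⟨_, exec_const hS hb (by omega) hf, by simp [Expr.eval], ?_⟩
    exact fun i hi => Function.update_of_ne (by omega) _ _
  | op o a b iha ihb =>
    intro ρ d env v hρ hv hr hb hf
    simp only [Expr.height] at hr
    obtain ⟨e1, x1, v1, k1⟩ := iha ρ d env v hρ hv (by omega) hb hf.1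
    obtain ⟨e2, x2, v2, k2⟩ := ihb ρ (d + 1) e1 v (fun j => (hρ j).trans (by omega))
      (fun j => (k1 _ (hρ j)).trans (hv j)) (by omega) x1.1 hf.2.1
    have hd : e2 d = a.eval x v := (k2 d (by omega)).trans v1
    have x3 := exec_op (x := x) hS x2.1 o (show d ≤ r by omega) (show d ≤ r by omega)
      (show d + 1 ≤ r by omega) (by rw [hd, v2]; exact hf.2.2)
    refine ⟨_, x1.seq (x2.seq x3), by simp [hd, v2, Expr.eval], fun i hi => ?_⟩
    rw [Function.update_of_ne (by omega), k2 i (by omega), k1 i hi]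
  | read a iha =>
    intro ρ d env v hρ hv hr hb hf
    simp only [Expr.height] at hr
    obtain ⟨e1, x1, v1, k1⟩ := iha ρ d env v hρ hv (by omega) hb hf
    have x2 := exec_read (x := x) hS x1.1 hB (show d ≤ r by omega) (show d ≤ r by omega)
    refine ⟨_, x1.seq x2, by simp [v1, Expr.eval], fun i hi => ?_⟩
    rw [Function.update_of_ne (by omega), k1 i hi]
  | scan a iha =>
    intro ρ d env v hρ hv hr hb hf
    simp only [Expr.height] at hr
    obtain ⟨e1, x1, v1, k1⟩ := iha ρ (d + 1) env v (fun j => (hρ j).trans (by omega)) hv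
      (by omega) hb hf.1
    have x2 := exec_const (x := x) (c := 0) hS x1.1 (show d ≤ r by omega) (by omega)
    obtain ⟨e3, x3, v3, k3⟩ := exec_testBit (x := x) hS x2.1 hB (show d + 1 + 2 ≤ r by omega)
    have hp : e3 (d + 1) = a.eval x v := by
      rw [k3 _ le_rfl, Function.update_of_ne (by omega), v1]
    obtain ⟨e4, x4, k4⟩ := exec_loop (x := x) (env := e3) hS (show d + 2 ≤ r by omega)
      (p := .seq (incr r d (d + 3)) <| .seq (incr r (d + 1) (d + 3)) (testBit r (d + 1)))
      (onesFrom x (a.eval x v))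
      (fun i e => e d = i ∧ e (d + 1) = a.eval x v + i ∧
        e (d + 2) = (if x[a.eval x v + i]? = some true then 1 else 0) ∧ ∀ j < d, e j = env j)
      (by
        rintro i hi e he ⟨c1, c2, c3, c4⟩
        rw [if_pos (onesFrom_of_lt hi)] at c3
        have hle := onesFrom_le (x := x) (a.eval x v)
        have hf2 := hf.2
        have y1 := exec_incr (x := x) hS he (show d ≤ r by omega) (show d + 3 ≤ r by omega)
          (by omega) (by omega)
        have y2 := exec_incr (x := x) hS y1.1 (show d + 1 ≤ r by omega) (show d + 3 ≤ r by omega)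
          (by omega) (by simp [c2]; omega)
        obtain ⟨e', y3, w3, l3⟩ := exec_testBit (x := x) hS y2.1 hB (show d + 1 + 2 ≤ r by omega)
        refine ⟨by omega, e', y1.seq (y2.seq y3), ?_, ?_, ?_, ?_⟩
        · rw [l3 d (by omega)]; simp [c1]
        · rw [l3 _ le_rfl]; simp [c2]; omega
        · rw [w3]; simp [c2, add_assoc]
        · intro j hj
          rw [l3 j (by omega), Function.update_of_ne (by omega), Function.update_of_ne (by omega),
            Function.update_of_ne (by omega), Function.update_of_ne (by omega), c4 j hj])
      (by
        rintro e ⟨_, _, c3, _⟩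
        rw [c3, if_neg (onesFrom_stop _)])
      x3.1
      ⟨by rw [k3 d (by omega)]; simp, by simpa using hp,
        by rw [v3, Function.update_of_ne (by omega), v1, add_zero], fun j hj => by
          rw [k3 j (by omega), Function.update_of_ne (by omega), k1 j (by omega)]⟩
    exact ⟨e4, x1.seq (x2.seq (x3.seq x4)), k4.1, k4.2.2.2⟩
  | sum a b iha ihb =>
    intro ρ d env v hρ hv hr hb hf
    simp only [Expr.height] at hr
    obtain ⟨e1, x1, v1, k1⟩ := iha ρ (d + 2) env v (fun j => (hρ j).trans (by omega)) hv
      (by omega) hb hf.1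
    have x2 := exec_const (x := x) (c := 0) hS x1.1 (show d ≤ r by omega) (by omega)
    have x3 := exec_const (x := x) (c := 0) hS x2.1 (show d + 1 ≤ r by omega) (by omega)
    have hN : a.eval x v ≤ B := v1 ▸ x1.1 (d + 2)
    -- Register `d` accumulates the sum, `d + 1` holds the bound variable, and `d + 2` counts down
    -- the remaining passes.
    obtain ⟨e4, x4, k4⟩ := exec_loop (x := x) hS (show d + 2 ≤ r by omega)
      (p := .seq (b.compile r (push (d + 1) ρ) (d + 3)) <|
        .seq (.instr (.add (rg r d) (rg r d) (rg r (d + 3)))) <|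
        .seq (incr r (d + 1) (d + 3)) (decr r (d + 2) (d + 3)))
      (a.eval x v)
      (fun i e => e d = ∑ i ∈ Finset.range i, b.eval x (push i v) ∧ e (d + 1) = i ∧
        e (d + 2) = a.eval x v - i ∧ ∀ j < d, e j = env j)
      (by
        rintro i hi e he ⟨c1, c2, c3, c4⟩
        obtain ⟨f1, y1, w1, l1⟩ := ihb (push (d + 1) ρ) (d + 3) e (push i v)
          (by rintro (_ | j) <;> simp; have := hρ j; omega)
          (by rintro (_ | j) <;> simp [c2, c4, hρ, hv]) (by omega) he (hf.2.1 i hi)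
        have hsum : f1 d + f1 (d + 3) = ∑ i ∈ Finset.range (i + 1), b.eval x (push i v) := by
          rw [l1 d (by omega), w1, c1, Finset.sum_range_succ]
        have y2 := exec_op (x := x) hS y1.1 .add (show d ≤ r by omega) (show d ≤ r by omega)
          (show d + 3 ≤ r by omega) (by
            simp only [Op.eval, hsum]
            exact (Finset.sum_le_sum_of_subset (Finset.range_subset_range.2 hi)).trans hf.2.2)
        have y3 := exec_incr (x := x) hS y2.1 (show d + 1 ≤ r by omega) (show d + 3 ≤ r by omega)
          (by omega) (by simp [l1, c2]; omega)
        have y4 := exec_decr (x := x) hS y3.1 (show d + 2 ≤ r by omega) (show d + 3 ≤ r by omega)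
          (by omega) (by omega)
        refine ⟨by omega, _, y1.seq (y2.seq (y3.seq y4)), ?_, ?_, ?_, ?_⟩
        · simp [Op.eval, hsum]
        · simp [l1, c2]
        · simp [l1, c3]; omega
        · intro j hj
          rw [Function.update_of_ne (by omega), Function.update_of_ne (by omega),
            Function.update_of_ne (by omega), Function.update_of_ne (by omega),
            Function.update_of_ne (by omega), l1 j (by omega), c4 j hj])
      (by rintro e ⟨_, _, c3, _⟩; rw [c3, Nat.sub_self])
      x3.1
      ⟨by simp, by simp, by simp [v1], fun j hj => by
          rw [Function.update_of_ne (by omega), Function.update_of_ne (by omega), k1 j (by omega)]⟩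
    exact ⟨e4, x1.seq (x2.seq (x3.seq x4)), k4.1, k4.2.2.2⟩

/-- `Exec` only covers programs that write nothing, so here the loop invariant also records the
output produced so far. -/
theorem Gen.compile_runs (hS : (r + 1) * B.size ≤ S) (hB : 2 ≤ B) (g : Gen) :
    ∀ (ρ : ℕ → ℕ) (d : ℕ) (env v : ℕ → ℕ) (out : List Bool), (∀ j, ρ j < d) →
      (∀ j, env (ρ j) = v j) → d + g.height ≤ r → (∀ i, env i ≤ B) → g.Fits x B v →
      ∃ env', (∀ i, env' i ≤ B) ∧ Runs x S (g.compile r ρ d) (State.ofEnv r env out)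
        (State.ofEnv r env' (out ++ g.out x v)) ∧ ∀ i < d, env' i = env i := by
  induction g with
  | bit a =>
    intro ρ d env v out hρ hv hr hb hf
    simp only [Gen.height] at hr
    obtain ⟨e1, x1, v1, k1⟩ := a.compile_exec hS hB ρ d env v hρ hv hr hb hf
    refine ⟨e1, x1.1, .seq (x1.2 out) ?_, k1⟩
    have hw : ∀ c : Bool, Runs x S (.instr (.write c)) (State.ofEnv r e1 out)
        (State.ofEnv r e1 (out ++ [c])) := fun c =>
      .instr (.write c) _ (State.bits_ofEnv_le hS x1.1)
        (State.bits_ofEnv_le (out := out ++ [c]) hS x1.1)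
    by_cases h0 : a.eval x v = 0
    · simpa [Gen.out, h0] using Runs.ite_neg (by rw [State.ofEnv_reg (by omega), v1, h0]) (hw false)
    · simpa [Gen.out, h0] using Runs.ite_pos (by rwa [State.ofEnv_reg (by omega), v1]) (hw true)
  | seq g h ihg ihh =>
    intro ρ d env v out hρ hv hr hb hf
    simp only [Gen.height] at hr
    obtain ⟨e1, b1, x1, k1⟩ := ihg ρ d env v out hρ hv (by omega) hb hf.1
    obtain ⟨e2, b2, x2, k2⟩ := ihh ρ d e1 v (out ++ g.out x v) hρ
      (fun j => (k1 _ (hρ j)).trans (hv j)) (by omega) b1 hf.2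
    refine ⟨e2, b2, ?_, fun i hi => (k2 i hi).trans (k1 i hi)⟩
    rw [Gen.out, ← List.append_assoc]
    exact .seq x1 x2
  | iter a g ihg =>
    intro ρ d env v out hρ hv hr hb hf
    simp only [Gen.height] at hr
    obtain ⟨e1, x1, v1, k1⟩ := a.compile_exec hS hB ρ (d + 1) env v
      (fun j => (hρ j).trans (by omega)) hv (by omega) hb hf.1
    have x2 := exec_const (x := x) (c := 0) hS x1.1 (show d ≤ r by omega) (by omega)
    have hN : a.eval x v ≤ B := v1 ▸ x1.1 (d + 1)
    obtain ⟨t, x3, e3, c0, rfl, c1, c2, c3⟩ := runs_loop (x := x) (S := S) (a := rg r (d + 1))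
      (p := .seq (g.compile r (push d ρ) (d + 2)) <|
        .seq (incr r d (d + 2)) (decr r (d + 1) (d + 2)))
      (a.eval x v)
      (fun i s => ∃ e : ℕ → ℕ, (∀ j, e j ≤ B) ∧ s = State.ofEnv r e
        (out ++ (List.range i).flatMap fun i => g.out x (push i v)) ∧ e d = i ∧
        e (d + 1) = a.eval x v - i ∧ ∀ j < d, e j = env j)
      (by
        rintro i hi s ⟨e, he, rfl, c1, c2, c3⟩
        refine ⟨by rw [State.ofEnv_reg (by omega), c2]; omega, ?_⟩
        obtain ⟨f1, b1, y1, l1⟩ := ihg (push d ρ) (d + 2) e (push i v)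
          (out ++ (List.range i).flatMap fun i => g.out x (push i v))
          (by rintro (_ | j) <;> simp; have := hρ j; omega)
          (by rintro (_ | j) <;> simp [c1, c3, hρ, hv]) (by omega) he (hf.2 i hi)
        have y2 := exec_incr (x := x) hS b1 (show d ≤ r by omega) (show d + 2 ≤ r by omega)
          (by omega) (by simp [l1, c1]; omega)
        have y3 := exec_decr (x := x) hS y2.1 (show d + 1 ≤ r by omega) (show d + 2 ≤ r by omega)
          (by omega) (by omega)
        refine ⟨_, .seq y1 ((y2.seq y3).2 _), _, y3.1, ?_, ?_, ?_, ?_⟩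
        · rw [List.range_succ, List.flatMap_append, List.append_assoc]; simp
        · simp [l1, c1]
        · simp [l1, c2]; omega
        · intro j hj
          rw [Function.update_of_ne (by omega), Function.update_of_ne (by omega),
            Function.update_of_ne (by omega), Function.update_of_ne (by omega), l1 j (by omega),
            c3 j hj])
      (by
        rintro s ⟨e, he, rfl, _, c2, _⟩
        exact ⟨by rw [State.ofEnv_reg (by omega), c2, Nat.sub_self], State.bits_ofEnv_le hS he⟩)
      ⟨_, x2.1, rfl, by simp, by simp [v1], fun j hj => by
        rw [Function.update_of_ne (by omega), k1 j (by omega)]⟩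
    refine ⟨e3, c0, .seq (x1.2 out) (.seq (x2.2 out) ?_), c3⟩
    simpa [Gen.out] using x3

end Semantics

/-! ### Polynomial bounds on values, and logarithmic space -/

/-- The values in an expression are bounded by a polynomial. -/
theorem Expr.exists_fits (e : Expr) : ∃ c, ∀ (x : List Bool) (M : ℕ) (v : ℕ → ℕ), (∀ j, v j ≤ M) →
    x.length ≤ M → e.eval x v ≤ (M + 2) ^ c ∧ ∀ B, (M + 2) ^ c ≤ B → e.Fits x B v := by
  have mono : ∀ M c c' : ℕ, c ≤ c' → (M + 2) ^ c ≤ (M + 2) ^ c' :=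
    fun M c c' h => Nat.pow_le_pow_right (by omega) h
  have base : ∀ M c : ℕ, 1 ≤ c → M + 2 ≤ (M + 2) ^ c := fun M c h => by simpa using mono M 1 c h
  induction e with
  | var j =>
    exact ⟨1, fun x M v hv _ => ⟨by have := hv j; simp only [Expr.eval, pow_one]; omega, fun _ _ => trivial⟩⟩
  | const c =>
    refine ⟨c, fun x M v hv _ => ?_⟩
    have : c ≤ (M + 2) ^ c := (Nat.lt_pow_self (by omega)).le
    exact ⟨this, fun B hB => this.trans hB⟩
  | op o a b iha ihb =>
    obtain ⟨ca, ha⟩ := iha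
    obtain ⟨cb, hb⟩ := ihb
    -- Exponents add in a product, and since `M + 2 ≥ 2` one extra factor absorbs the doubling in a
    -- sum.
    refine ⟨ca + cb + 1, fun x M v hv hx => ?_⟩
    obtain ⟨a1, a2⟩ := ha x M v hv hx
    obtain ⟨b1, b2⟩ := hb x M v hv hx
    have hle : o.eval (a.eval x v) (b.eval x v) ≤ (M + 2) ^ (ca + cb + 1) := by
      have ma := mono M ca (ca + cb) (by omega)
      have mb := mono M cb (ca + cb) (by omega)
      have h2 : 2 * (M + 2) ^ (ca + cb) ≤ (M + 2) ^ (ca + cb + 1) := by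
        rw [pow_succ, mul_comm]; exact Nat.mul_le_mul_left _ (by omega)
      cases o
      · simp only [Op.eval]; omega
      · simp only [Op.eval]; omega
      · simp only [Op.eval]
        have := Nat.mul_le_mul a1 b1
        rw [← pow_add] at this; omega
      · simp only [Op.eval]
        have := Nat.div_le_self (a.eval x v) (b.eval x v)
        omega
    exact ⟨hle, fun B hB => ⟨a2 B ((mono M _ _ (by omega)).trans hB),
      b2 B ((mono M _ _ (by omega)).trans hB), hle.trans hB⟩⟩
  | read a iha =>
    obtain ⟨ca, ha⟩ := iha
    refine ⟨ca + 1, fun x M v hv hx => ⟨?_, fun B hB =>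
      (ha x M v hv hx).2 B ((mono M _ _ (by omega)).trans hB)⟩⟩
    have := base M (ca + 1) (by omega)
    have h2 : bitAt x (a.eval x v) ≤ 2 := by unfold bitAt; split <;> omega
    simp only [Expr.eval]; omega
  | scan a iha =>
    obtain ⟨ca, ha⟩ := iha
    refine ⟨ca + 1 + 1, fun x M v hv hx => ?_⟩
    have m1 := base M (ca + 1) (by omega)
    have m2 := mono M ca (ca + 1) (by omega)
    have h2 : 2 * (M + 2) ^ (ca + 1) ≤ (M + 2) ^ (ca + 1 + 1) := by
      rw [pow_succ _ (ca + 1), mul_comm]; exact Nat.mul_le_mul_left _ (by omega)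
    have a1 := (ha x M v hv hx).1
    have h3 := onesFrom_le (x := x) (a.eval x v)
    exact ⟨by simp only [Expr.eval]; omega, fun B hB => ⟨(ha x M v hv hx).2 B (by omega), by omega⟩⟩
  | sum a b iha ihb =>
    obtain ⟨ca, ha⟩ := iha
    obtain ⟨cb, hb⟩ := ihb
    -- The bound variable ranges up to `(M + 2) ^ ca`, so the bound for `b` is used with `(M + 2) ^
    -- (ca + 1)` in place of `M`. This gives at most `(M + 2) ^ ((ca + 2) * cb)` per summand, and
    -- there are at most `(M + 2) ^ ca` summands.
    refine ⟨(ca + 2) * cb + ca + 2, fun x M v hv hx => ?_⟩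
    obtain ⟨a1, a2⟩ := ha x M v hv hx
    have hp : ∀ i < a.eval x v, ∀ j, push i v j ≤ (M + 2) ^ (ca + 1) := by
      have m1 := base M (ca + 1) (by omega)
      have m2 := mono M ca (ca + 1) (by omega)
      rintro i hi (_ | j)
      · simp only [push_zero]; omega
      · have := hv j
        simp only [push_succ]; omega
    have hM : ((M + 2) ^ (ca + 1) + 2) ^ cb ≤ (M + 2) ^ ((ca + 2) * cb) := by
      rw [pow_mul]
      refine Nat.pow_le_pow_left ?_ _
      have m1 := base M (ca + 1) (by omega)
      have h2 : 2 * (M + 2) ^ (ca + 1) ≤ (M + 2) ^ (ca + 1 + 1) := by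
        rw [pow_succ _ (ca + 1), mul_comm]; exact Nat.mul_le_mul_left _ (by omega)
      rw [show ca + 2 = ca + 1 + 1 by rfl]
      omega
    have hxM : x.length ≤ (M + 2) ^ (ca + 1) := by
      have m1 := base M (ca + 1) (by omega)
      omega
    have hle : ∑ i ∈ Finset.range (a.eval x v), b.eval x (push i v) ≤
        (M + 2) ^ ((ca + 2) * cb + ca + 2) := by
      have h1 := Finset.sum_le_card_nsmul (Finset.range (a.eval x v))
        (fun i => b.eval x (push i v)) _ fun i hi =>
          ((hb x _ (push i v) (hp i (Finset.mem_range.1 hi)) hxM).1.trans hM)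
      refine h1.trans ?_
      rw [Finset.card_range, smul_eq_mul]
      refine (Nat.mul_le_mul_right _ a1).trans ?_
      rw [← pow_add]
      exact mono M _ _ (by omega)
    exact ⟨hle, fun B hB => ⟨a2 B ((mono M _ _ (by omega)).trans hB), fun i hi =>
      (hb x _ (push i v) (hp i hi) hxM).2 B (hM.trans ((mono M _ _ (by omega)).trans hB)),
      hle.trans hB⟩⟩

/-- The values in a generator are bounded by a polynomial. -/
theorem Gen.exists_fits (g : Gen) : ∃ c, ∀ (x : List Bool) (M : ℕ) (v : ℕ → ℕ), (∀ j, v j ≤ M) →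
    x.length ≤ M → ∀ B, (M + 2) ^ c ≤ B → g.Fits x B v := by
  have mono : ∀ M c c' : ℕ, c ≤ c' → (M + 2) ^ c ≤ (M + 2) ^ c' :=
    fun M c c' h => Nat.pow_le_pow_right (by omega) h
  have base : ∀ M c : ℕ, 1 ≤ c → M + 2 ≤ (M + 2) ^ c := fun M c h => by simpa using mono M 1 c h
  induction g with
  | bit a =>
    obtain ⟨c, h⟩ := a.exists_fits
    exact ⟨c, fun x M v hv hx => (h x M v hv hx).2⟩
  | seq g h ihg ihh =>
    obtain ⟨cg, hg⟩ := ihg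
    obtain ⟨ch, hh⟩ := ihh
    exact ⟨cg + ch, fun x M v hv hx B hB => ⟨hg x M v hv hx B ((mono M _ _ (by omega)).trans hB),
      hh x M v hv hx B ((mono M _ _ (by omega)).trans hB)⟩⟩
  | iter a g ihg =>
    obtain ⟨ca, ha⟩ := a.exists_fits
    obtain ⟨cg, hg⟩ := ihg
    -- As for sums, except that output is not stored in registers, so the number of passes does not
    -- multiply the bound.
    refine ⟨(ca + 2) * cg + ca, fun x M v hv hx B hB => ?_⟩
    obtain ⟨a1, a2⟩ := ha x M v hv hx
    have m1 := base M (ca + 1) (by omega)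
    have m2 := mono M ca (ca + 1) (by omega)
    have h2 : 2 * (M + 2) ^ (ca + 1) ≤ (M + 2) ^ (ca + 1 + 1) := by
      rw [pow_succ _ (ca + 1), mul_comm]; exact Nat.mul_le_mul_left _ (by omega)
    refine ⟨a2 B ((mono M _ _ (by omega)).trans hB), fun i hi => ?_⟩
    refine hg x ((M + 2) ^ (ca + 1)) (push i v) ?_ (by omega) B ?_
    · rintro (_ | j)
      · simp only [push_zero]; omega
      · have := hv j
        simp only [push_succ]; omega
    · refine le_trans ?_ ((mono M ((ca + 2) * cg) _ (by omega)).trans hB)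
      rw [pow_mul]
      refine Nat.pow_le_pow_left ?_ _
      rw [show ca + 2 = ca + 1 + 1 by rfl]
      omega

/-- The output of a generator is computed in logarithmic space. -/
theorem Gen.outputs (g : Gen) : ∃ (r : ℕ) (p : Prog r) (C : ℕ), ∀ x : List Bool,
    p.Outputs x (g.out x fun _ => 0) (C * (1 + Nat.log 2 x.length)) := by
  obtain ⟨c, hc⟩ := g.exists_fits
  -- Register `0` holds the value `0` of all free variables and work starts at register `1`, whence
  -- the summand `1`.
  set r := g.height + 1 with hr
  refine ⟨r + 1, g.compile r (fun _ => 0) 1, (r + 1) * (3 * (c + 1) + 1), fun x => ?_⟩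
  set L := x.length with hL
  have hlt : L < 2 ^ (Nat.log 2 L + 1) := Nat.lt_pow_succ_log_self (by omega) L
  -- The bound on all values is `(L + 2) ^ (c + 1)`, whose bit length is linear in `Nat.log 2 L`.
  -- The exponent `c + 1` instead of `c` makes it at least `2`.
  have hB : (L + 2) ^ (c + 1) < 2 ^ ((Nat.log 2 L + 3) * (c + 1) + 1) := by
    rw [pow_succ 2, pow_mul]
    have h1 : L + 2 ≤ 2 ^ (Nat.log 2 L + 3) := by
      rw [pow_succ, pow_succ]
      have := Nat.one_le_two_pow (n := Nat.log 2 L + 1)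
      omega
    have h2 := Nat.pow_le_pow_left h1 (c + 1)
    have h3 : 0 < (2 ^ (Nat.log 2 L + 3)) ^ (c + 1) := by positivity
    omega
  have hsize := Nat.size_le.2 hB
  have hS : (r + 1) * ((L + 2) ^ (c + 1)).size ≤
      (r + 1) * (3 * (c + 1) + 1) * (1 + Nat.log 2 L) := by
    rw [mul_assoc]
    refine Nat.mul_le_mul_left _ (hsize.trans ?_)
    nlinarith [Nat.zero_le (Nat.log 2 L * c)]
  have hB2 : 2 ≤ (L + 2) ^ (c + 1) := by
    have := Nat.pow_le_pow_right (show 0 < L + 2 by omega) (show 1 ≤ c + 1 by omega)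
    rw [pow_one] at this
    omega
  obtain ⟨env', -, h, -⟩ := g.compile_runs (x := x) hS hB2 (fun _ => 0) 1 (fun _ => 0) (fun _ => 0) []
    (by simp) (by simp) (by omega) (by simp)
    (hc x L _ (by simp) le_rfl _ (Nat.pow_le_pow_right (by omega) (by omega)))
  exact ⟨_, h, by simp [State.ofEnv]⟩

end RAM

/-! ### Chains of moves -/

namespace PartitionedDSInstance

/-- `D` is reached from the initial dominating set by exactly `ℓ` moves. -/
inductive Reach (rule : TokenRule) (A : PartitionedDSInstance) : ℕ → Finset (Fin A.n) → Prop
  | start : Reach rule A 0 A.Dinit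
  | step {ℓ : ℕ} {D D' : Finset (Fin A.n)} (h : Reach rule A ℓ D) (hm : A.Move rule D D')
      (hD : IsTokenDominatingSet A.G A.part D') : Reach rule A (ℓ + 1) D'

lemma Reach.valid {rule : TokenRule} {A : PartitionedDSInstance} {ℓ : ℕ} {D : Finset (Fin A.n)}
    (h : A.Reach rule ℓ D) : IsTokenDominatingSet A.G A.part D := by
  cases h with
  | start => exact A.valid_init
  | step _ _ hD => exact hD

/-- This permits induction on the last move; conversely, a sequence is extended past its end by the
new set. -/
lemma hasSeq_iff_reach {rule : TokenRule} {A : PartitionedDSInstance} {ℓ : ℕ} :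
    A.HasSeq rule ℓ ↔ A.Reach rule ℓ A.Dfin := by
  constructor
  · rintro ⟨D, h0, hℓ, hv, hm⟩
    have key : ∀ j ≤ ℓ, A.Reach rule j (D j) := by
      intro j
      induction j with
      | zero => exact fun _ => h0 ▸ .start
      | succ j ih => exact fun hj => (ih (by omega)).step (hm j hj) (hv _ hj)
    exact hℓ ▸ key ℓ le_rfl
  · intro h
    suffices ∀ ℓ D', A.Reach rule ℓ D' → ∃ D : ℕ → Finset (Fin A.n), D 0 = A.Dinit ∧ D ℓ = D' ∧
        (∀ j ≤ ℓ, IsTokenDominatingSet A.G A.part (D j)) ∧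
        ∀ j < ℓ, A.Move rule (D j) (D (j + 1)) from this ℓ _ h
    intro ℓ D' h
    induction h with
    | start => exact ⟨fun _ => A.Dinit, rfl, rfl, fun _ _ => A.valid_init, by simp⟩
    | @step ℓ D D' h hm hD ih =>
      obtain ⟨E, e0, e1, e2, e3⟩ := ih
      refine ⟨fun j => if j ≤ ℓ then E j else D', by simp [e0], by simp, fun j hj => ?_,
        fun j hj => ?_⟩
      · by_cases h' : j ≤ ℓ <;> simp [h', e2, hD]
      · rcases Nat.lt_succ_iff_lt_or_eq.1 hj with h' | rfl
        · simpa [h'.le, Nat.succ_le_of_lt h'] using e3 j h'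
        · simpa [e1] using hm

/-- The set `D` contains exactly one vertex of every token set. -/
def IsTransversal (A : PartitionedDSInstance) (D : Finset (Fin A.n)) : Prop :=
  ∀ i : Fin A.k, ∃! v, v ∈ D ∧ A.part v = i

variable {A : PartitionedDSInstance}

lemma IsTransversal.eq_of_mem {D : Finset (Fin A.n)} (h : A.IsTransversal D) {a b : Fin A.n}
    (ha : a ∈ D) (hb : b ∈ D) (hab : A.part a = A.part b) : a = b :=
  (h (A.part b)).unique ⟨ha, hab⟩ ⟨hb, rfl⟩

lemma IsTransversal.exists_mem {D : Finset (Fin A.n)} (h : A.IsTransversal D) (a : Fin A.n) :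
    ∃ b ∈ D, A.part b = A.part a :=
  let ⟨b, hb, _⟩ := h (A.part a)
  ⟨b, hb.1, hb.2⟩

end PartitionedDSInstance

namespace SlideToJump

open PartitionedDSInstance

/-! ### The vertices of the new graph -/

/-- The kinds of vertices of the new graph: two copies `T`, `S` of the vertices of the old graph,
the values `C c` of a control token, constraints `X a b`, the fixed vertex `q`, and padding. -/
inductive View (n : ℕ)
  | T (a : Fin n)
  | S (a : Fin n)
  | C (c : Fin (n + 2) × Fin (n + 2))
  | X (a b : Fin n)
  | q
  | pad
  deriving DecidableEq

/-- The kind of a vertex given by its three digits. -/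
def decode (n τ a b : ℕ) : View n :=
  if τ = 0 then (if h : a < n ∧ b < n then .X ⟨a, h.1⟩ ⟨b, h.2⟩ else .pad)
  else if τ = 1 then .C (Fin.ofNat (n + 2) a, Fin.ofNat (n + 2) b)
  else if b = 0 then (if h : a < n then .T ⟨a, h⟩ else if a = n then .q else .pad)
  else if b = 1 then (if h : a < n then .S ⟨a, h⟩ else .pad)
  else .pad

/-- The number of vertices of the new graph. -/
abbrev size (n : ℕ) : ℕ := 3 * (n + 2) * (n + 2)

/-- The kind of a vertex. -/
def view {n : ℕ} (u : Fin (size n)) : View n :=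
  decode n (u / (n + 2) / (n + 2)) (u / (n + 2) % (n + 2)) (u % (n + 2))

lemma number_lt {n τ a b : ℕ} (hτ : τ < 3) (ha : a < n + 2) (hb : b < n + 2) :
    (τ * (n + 2) + a) * (n + 2) + b < size n := by
  have h1 : τ * (n + 2) + a + 1 ≤ 3 * (n + 2) := by nlinarith
  have h2 := Nat.mul_le_mul_right (n + 2) h1
  unfold size
  nlinarith

/-- The vertex with given digits. -/
def number (n τ a b : ℕ) (hτ : τ < 3) (ha : a < n + 2) (hb : b < n + 2) : Fin (size n) :=
  ⟨(τ * (n + 2) + a) * (n + 2) + b, number_lt hτ ha hb⟩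

lemma digits {m c b : ℕ} (hb : b < m) : (c * m + b) / m = c ∧ (c * m + b) % m = b := by
  have hm : 0 < m := by omega
  refine ⟨?_, ?_⟩
  · rw [mul_comm, Nat.mul_add_div hm, Nat.div_eq_of_lt hb, add_zero]
  · rw [mul_comm, Nat.mul_add_mod, Nat.mod_eq_of_lt hb]

lemma view_number {n τ a b : ℕ} (hτ : τ < 3) (ha : a < n + 2) (hb : b < n + 2) :
    view (number n τ a b hτ ha hb) = decode n τ a b := by
  simp only [view, number, (digits hb).1, (digits hb).2, (digits ha).1, (digits ha).2]

lemma exists_number {n : ℕ} (u : Fin (size n)) :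
    ∃ τ a b, ∃ (hτ : τ < 3) (ha : a < n + 2) (hb : b < n + 2), u = number n τ a b hτ ha hb := by
  refine ⟨u / (n + 2) / (n + 2), u / (n + 2) % (n + 2), u % (n + 2), ?_,
    Nat.mod_lt _ (by omega), Nat.mod_lt _ (by omega), ?_⟩
  · rw [Nat.div_lt_iff_lt_mul (by omega), Nat.div_lt_iff_lt_mul (by omega)]
    exact u.2
  · apply Fin.ext
    simp only [number]
    rw [Nat.div_add_mod', Nat.div_add_mod']

/-- A vertex of given kind. -/
def enc {n : ℕ} : View n → Fin (size n)
  | .T a => number n 2 a 0 (by omega) (by omega) (by omega)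
  | .S a => number n 2 a 1 (by omega) (by omega) (by omega)
  | .C c => number n 1 c.1 c.2 (by omega) c.1.2 c.2.2
  | .X a b => number n 0 a b (by omega) (by omega) (by omega)
  | .q => number n 2 n 0 (by omega) (by omega) (by omega)
  | .pad => number n 2 (n + 1) 0 (by omega) (by omega) (by omega)

@[simp] lemma view_enc {n : ℕ} (x : View n) : view (enc x) = x := by
  cases x with
  | C c =>
    simp only [enc, view_number, decode, Fin.ofNat, one_ne_zero, if_false, if_true,
      Nat.mod_eq_of_lt c.1.2, Nat.mod_eq_of_lt c.2.2]
  | _ => simp [enc, view_number, decode]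

lemma enc_view {n : ℕ} {u : Fin (size n)} (h : view u ≠ .pad) : enc (view u) = u := by
  obtain ⟨τ, a, b, hτ, ha, hb, rfl⟩ := exists_number u
  rw [view_number] at h ⊢
  obtain rfl | rfl | rfl : τ = 0 ∨ τ = 1 ∨ τ = 2 := by omega
  · simp only [decode, if_true] at h ⊢
    split_ifs at h ⊢ with h1
    · rfl
    · exact absurd rfl h
  · simp [decode, enc, number, Nat.mod_eq_of_lt ha, Nat.mod_eq_of_lt hb]
  · simp only [decode, OfNat.ofNat_ne_zero, OfNat.ofNat_ne_one, if_false] at h ⊢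
    split_ifs at h ⊢ with h1 h2 h3 h4 h5 <;> first
      | exact absurd rfl h
      | (subst h1; rfl)
      | (subst h1 h3; rfl)
      | (subst h4; rfl)

/-- The kind `pad` is excluded because several vertices share it; every other kind has one vertex.
-/
lemma eq_enc_iff {n : ℕ} {u : Fin (size n)} {x : View n} (hx : x ≠ .pad) :
    u = enc x ↔ view u = x := by
  constructor
  · rintro rfl; exact view_enc x
  · rintro rfl; exact (enc_view hx).symm

/-- A second vertex of kind `pad`. -/
def pad' (n : ℕ) : Fin (size n) := number n 2 n 1 (by omega) (by omega) (by omega)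

lemma view_pad' (n : ℕ) : view (pad' n) = .pad := by
  simp [pad', view_number, decode]

lemma pad'_ne (n : ℕ) : pad' n ≠ enc .pad := by
  simp [pad', enc, number]; nlinarith

/-! ### The new instance -/

/-- The control value `c` is the pair `a, b` in some order. -/
def Hits {n : ℕ} (c : Fin (n + 2) × Fin (n + 2)) (a b : Fin n) : Prop :=
  ((c.1 : ℕ) = a ∧ (c.2 : ℕ) = b) ∨ ((c.1 : ℕ) = b ∧ (c.2 : ℕ) = a)

lemma Hits.symm {n : ℕ} {c : Fin (n + 2) × Fin (n + 2)} {a b : Fin n} (h : Hits c a b) :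
    Hits c b a := Or.symm h

/-- This is what confines the difference of the two copies to one token set. -/
lemma Hits.eq_or {n : ℕ} {c : Fin (n + 2) × Fin (n + 2)} {a b a' b' : Fin n} (h : Hits c a b)
    (h' : Hits c a' b') : (a' = a ∧ b' = b) ∨ (a' = b ∧ b' = a) := by
  simp only [Hits, Fin.ext_iff] at *
  omega

variable (A : PartitionedDSInstance)

/-- The index of the token set of a vertex. -/
def partIdx : View A.n → ℕ
  | .T a => A.part a
  | .S a => A.k + A.part a
  | .C _ => 2 * A.k
  | _ => 2 * A.k + 1

lemma partIdx_lt (x : View A.n) : partIdx A x < 2 * A.k + 2 := by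
  cases x <;> simp only [partIdx] <;> omega

/-- The token set of a vertex. -/
def newPart (u : Fin (size A.n)) : Fin (2 * A.k + 2) := ⟨partIdx A (view u), partIdx_lt A _⟩

/-- The edges of the new graph, oriented. -/
def Arc : View A.n → View A.n → Prop
  | .q, .q => False
  | .q, .X a b => A.part a ≠ A.part b
  | .q, _ => True
  | .T w, .X a b => if a = b then w = a ∨ A.G.Adj w a else A.part w = A.part a ∧ w ≠ a
  | .S w, .X a b => a ≠ b ∧ A.part w = A.part b ∧ w ≠ b
  | .C c, .X a b => A.G.Adj a b ∧ Hits c a b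
  | _, _ => False

/-- The new graph. -/
def newGraph : SimpleGraph (Fin (size A.n)) where
  Adj u v := Arc A (view u) (view v) ∨ Arc A (view v) (view u)
  symm := ⟨fun _ _ h => h.symm⟩
  loopless := ⟨fun u h => by cases hu : view u <;> simp [hu, Arc] at h⟩

/-- The kinds of vertices that carry tokens if these are on `t`, `s` and `c`. -/
def Occupied {n : ℕ} (t s : Finset (Fin n)) (c : Fin (n + 2) × Fin (n + 2)) : View n → Prop
  | .T a => a ∈ t
  | .S a => a ∈ s
  | .C c' => c' = c
  | .q => True
  | _ => False

open Classical in
/-- The token placement given by `t`, `s` and `c`. -/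
noncomputable def place {n : ℕ} (t s : Finset (Fin n)) (c : Fin (n + 2) × Fin (n + 2)) :
    Finset (Fin (size n)) :=
  Finset.univ.filter fun u => Occupied t s c (view u)

lemma mem_place {n : ℕ} {t s : Finset (Fin n)} {c : Fin (n + 2) × Fin (n + 2)}
    {u : Fin (size n)} : u ∈ place t s c ↔ Occupied t s c (view u) := by
  simp [place]

lemma place_inj {n : ℕ} {t s t' s' : Finset (Fin n)} {c c' : Fin (n + 2) × Fin (n + 2)}
    (h : place t s c = place t' s' c') : t = t' ∧ s = s' ∧ c = c' := by
  have h' : ∀ x : View n, Occupied t s c x ↔ Occupied t' s' c' x := fun x => by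
    rw [← view_enc x, ← mem_place, h, mem_place]
  exact ⟨Finset.ext fun a => h' (.T a), Finset.ext fun a => h' (.S a), (h' (.C c)).1 rfl⟩

/-! ### The valid placements of the new instance -/

variable {A}

/-- The placements of tokens that the new instance allows. -/
structure Allowed (t s : Finset (Fin A.n)) (c : Fin (A.n + 2) × Fin (A.n + 2)) : Prop where
  left : IsTokenDominatingSet A.G A.part t
  right : A.IsTransversal s
  edge : ∀ a ∈ t, ∀ b ∈ s, A.part a = A.part b → a ≠ b → A.G.Adj a b ∧ Hits c a b

/-- The token on `q` covers all but the constraints inside one token set. On the diagonal,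
domination by `t` helps. Off it, a `T`-token away from `a` or an `S`-token away from `b` suffices,
and in the remaining case `edge` supplies the control token. -/
theorem Allowed.valid {t s : Finset (Fin A.n)} {c : Fin (A.n + 2) × Fin (A.n + 2)}
    (h : Allowed t s c) : IsTokenDominatingSet (newGraph A) (newPart A) (place t s c) := by
  have ht : A.IsTransversal t := h.left.2
  have mem : ∀ {x}, Occupied t s c x → enc x ∈ place t s c := fun hx => by
    rwa [mem_place, view_enc]
  refine ⟨fun u => ?_, fun i => ?_⟩
  · simp only [newGraph]
    by_cases hq : view u = .q
    · left; rw [mem_place, hq]; trivial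
    right
    by_cases hX : ∃ a b, view u = .X a b ∧ A.part a = A.part b
    · obtain ⟨a, b, hu, hab⟩ := hX
      by_cases hne : a = b
      · subst hne
        obtain ⟨w, hw, hwa⟩ : ∃ w ∈ t, w = a ∨ A.G.Adj w a := by
          rcases h.left.1 a with h' | ⟨w, hw, h'⟩
          · exact ⟨a, h', .inl rfl⟩
          · exact ⟨w, hw, .inr h'.symm⟩
        exact ⟨enc (.T w), mem hw, .inr (by simp [hu, Arc, hwa])⟩
      obtain ⟨w, hw, hwa⟩ := ht.exists_mem a
      by_cases hw' : w = a
      · obtain ⟨y, hy, hyb⟩ := h.right.exists_mem b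
        by_cases hy' : y = b
        · subst hw' hy'
          exact ⟨enc (.C c), mem rfl, .inr (by simpa [hu, Arc] using h.edge w hw y hy hab hne)⟩
        · exact ⟨enc (.S y), mem hy, .inr (by simp [hu, Arc, hne, hyb, hy'])⟩
      · exact ⟨enc (.T w), mem hw, .inr (by simp [hu, Arc, hne, hwa, hw'])⟩
    · refine ⟨enc .q, mem trivial, .inr ?_⟩
      rw [view_enc]
      cases hu : view u with
      | X a b => exact fun hab => hX ⟨a, b, hu, hab⟩
      | q => exact absurd hu hq
      | _ => trivial
  · have key : ∀ x : View A.n, x ≠ .pad → Occupied t s c x → partIdx A x = i →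
        (∀ y, Occupied t s c y → partIdx A y = i → y = x) →
        ∃! u, u ∈ place t s c ∧ newPart A u = i := by
      intro x hp hx hi hy
      refine ⟨enc x, ⟨mem hx, Fin.ext (by simpa [newPart] using hi)⟩, fun u hu => ?_⟩
      exact (eq_enc_iff hp).2 (hy _ (mem_place.1 hu.1) (congrArg Fin.val hu.2))
    -- The token sets come in four ranges: those of `T`, those of `S`, the control set, and the set
    -- of `q`.
    have hi := i.2
    rcases lt_or_ge (i : ℕ) A.k with h1 | h1
    · obtain ⟨a, ⟨ha, hai⟩, -⟩ := ht ⟨i, h1⟩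
      have hai' : (A.part a : ℕ) = i := congrArg Fin.val hai
      refine key (.T a) (by simp) ha (by simpa [partIdx] using hai') fun y hy hyi => ?_
      cases y with
      | T b => rw [ht.eq_of_mem hy ha (Fin.ext (by simp only [partIdx] at hyi; omega))]
      | _ => simp only [partIdx] at hyi; omega
    rcases lt_or_ge (i : ℕ) (2 * A.k) with h2 | h2
    · obtain ⟨a, ⟨ha, hai⟩, -⟩ := h.right ⟨i - A.k, by omega⟩
      have hai' : (A.part a : ℕ) = i - A.k := congrArg Fin.val hai
      refine key (.S a) (by simp) ha (by simp only [partIdx]; omega) fun y hy hyi => ?_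
      cases y with
      | S b => rw [h.right.eq_of_mem hy ha (Fin.ext (by simp only [partIdx] at hyi; omega))]
      | T b => simp only [partIdx] at hyi; omega
      | _ => simp only [partIdx] at hyi; omega
    rcases Nat.lt_or_ge i (2 * A.k + 1) with h3 | h3
    · refine key (.C c) (by simp) rfl (by simp only [partIdx]; omega) fun y hy hyi => ?_
      cases y with
      | C c' => rw [show c' = c from hy]
      | T b => simp only [partIdx] at hyi; omega
      | S b => simp only [partIdx] at hyi; omega
      | _ => simp only [partIdx] at hyi; omega
    · refine key .q (by simp) trivial (by simp only [partIdx]; omega) fun y hy hyi => ?_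
      cases y with
      | q => rfl
      | X => exact hy.elim
      | pad => exact hy.elim
      | T b => simp only [partIdx] at hyi; omega
      | S b => simp only [partIdx] at hyi; omega
      | C b => simp only [partIdx] at hyi; omega

/-- Once the token on `q` is forced, constraints and padding carry no tokens, so each constraint
must be dominated through an arc. The possible sources of that arc give the conditions of `Allowed`.
-/
theorem exists_allowed {D : Finset (Fin (size A.n))}
    (h : IsTokenDominatingSet (newGraph A) (newPart A) D) :
    ∃ t s c, D = place t s c ∧ Allowed t s c := by
  classical
  have uniq : ∀ {u v}, u ∈ D → v ∈ D → partIdx A (view u) = partIdx A (view v) → u = v :=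
    fun hu hv huv => (h.2 (newPart A _)).unique ⟨hu, Fin.ext huv⟩ ⟨hv, rfl⟩
  have hq : enc .q ∈ D := by
    -- A padding vertex has no neighbour but `q`, and two of them cannot both carry the token of
    -- their common token set.
    have hpad : ∀ u, view u = .pad → enc .q ∉ D → u ∈ D := by
      intro u hu hD
      rcases h.1 u with h' | ⟨w, hw, h'⟩
      · exact h'
      · simp only [newGraph, hu] at h'
        cases hw' : view w <;> simp [hw', Arc] at h'
        exact absurd ((eq_enc_iff (by simp)).2 hw' ▸ hw) hD
    by_contra hD
    exact pad'_ne A.n (uniq (hpad _ (view_pad' _) hD) (hpad _ (view_enc _) hD)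
      (by rw [view_pad', view_enc]))
  have hfix : ∀ u ∈ D, partIdx A (view u) = 2 * A.k + 1 → u = enc .q := fun u hu hi =>
    uniq hu hq (by rw [hi, view_enc]; rfl)
  obtain ⟨u, ⟨huD, hu⟩, -⟩ := h.2 ⟨2 * A.k, by omega⟩
  obtain ⟨c, hc⟩ : ∃ c, view u = .C c := by
    have hu' := congrArg Fin.val hu
    simp only [newPart] at hu'
    cases hv : view u with
    | C c => exact ⟨c, rfl⟩
    | T a => simp only [hv, partIdx] at hu'; omega
    | S a => simp only [hv, partIdx] at hu'; omega
    | _ => simp [hv, partIdx] at hu'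
  obtain rfl := (eq_enc_iff (by simp)).2 hc
  set t := Finset.univ.filter fun a => enc (.T a) ∈ D with ht
  set s := Finset.univ.filter fun a => enc (.S a) ∈ D with hs
  have hD : D = place t s c := by
    ext v
    rw [mem_place]
    by_cases hp : view v = .pad
    · rw [hp]
      refine ⟨fun hv => ?_, fun hv => hv.elim⟩
      have := hfix v hv (by rw [hp]; rfl)
      rw [eq_enc_iff (by simp), hp] at this
      exact absurd this (by simp)
    rw [← enc_view hp]
    simp only [view_enc]
    cases hv : view v with
    | T a => simp [Occupied, ht]
    | S a => simp [Occupied, hs]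
    | q => simpa [Occupied] using hq
    | pad => exact absurd hv hp
    | X a b =>
      refine ⟨fun hv => ?_, fun hv => hv.elim⟩
      have := hfix _ hv (by rw [view_enc]; rfl)
      rw [eq_enc_iff (by simp), view_enc] at this
      exact absurd this (by simp)
    | C c' =>
      refine ⟨fun hv => ?_, fun hv => ?_⟩
      · have := uniq hv huD (by simp [partIdx])
        rw [eq_enc_iff (by simp), view_enc] at this
        simpa [Occupied] using this
      · rw [show c' = c from hv]; exact huD
  have htr : A.IsTransversal t := by
    intro i
    obtain ⟨v, ⟨hv, hvi⟩, hun⟩ := h.2 ⟨i, by omega⟩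
    have hvi' := congrArg Fin.val hvi
    simp only [newPart] at hvi'
    obtain ⟨a, ha⟩ : ∃ a, view v = .T a := by
      cases hv' : view v with
      | T a => exact ⟨a, rfl⟩
      | _ => simp only [hv', partIdx] at hvi'; omega
    obtain rfl := (eq_enc_iff (by simp)).2 ha
    refine ⟨a, ⟨by simpa [ht] using hv, Fin.ext (by simpa [partIdx] using hvi')⟩, ?_⟩
    rintro b ⟨hb, hbi⟩
    have := hun (enc (.T b)) ⟨by simpa [ht] using hb, Fin.ext (by simp [newPart, partIdx, hbi])⟩
    rw [eq_enc_iff (by simp), view_enc] at this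
    simpa using this
  have hsr : A.IsTransversal s := by
    intro i
    obtain ⟨v, ⟨hv, hvi⟩, hun⟩ := h.2 ⟨A.k + i, by omega⟩
    have hvi' := congrArg Fin.val hvi
    simp only [newPart] at hvi'
    obtain ⟨a, ha⟩ : ∃ a, view v = .S a := by
      cases hv' : view v with
      | S a => exact ⟨a, rfl⟩
      | T a => simp only [hv', partIdx] at hvi'; omega
      | _ => simp only [hv', partIdx] at hvi'; omega
    obtain rfl := (eq_enc_iff (by simp)).2 ha
    refine ⟨a, ⟨by simpa [hs] using hv, Fin.ext (by simpa [partIdx] using hvi')⟩, ?_⟩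
    rintro b ⟨hb, hbi⟩
    have := hun (enc (.S b)) ⟨by simpa [hs] using hb, Fin.ext (by simp [newPart, partIdx, hbi])⟩
    rw [eq_enc_iff (by simp), view_enc] at this
    simpa using this
  have dom : ∀ a b : Fin A.n, A.part a = A.part b →
      ∃ x, Occupied t s c x ∧ Arc A x (.X a b) := by
    intro a b hab
    rcases h.1 (enc (.X a b)) with h' | ⟨w, hw, h'⟩
    · rw [hD, mem_place, view_enc] at h'; exact h'.elim
    · rw [hD, mem_place] at hw
      refine ⟨view w, hw, ?_⟩
      simp only [newGraph, view_enc] at h'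
      -- Constraints have no outgoing arcs, so the edge comes from an arc into `X a b`.
      exact h'.resolve_left fun h => by cases hw' : view w <;> simp [Arc] at h
  refine ⟨t, s, c, hD, ⟨⟨fun a => ?_, htr⟩, hsr, fun a ha b hb hab hne => ?_⟩⟩
  -- On the diagonal, neither `S`-tokens nor the control token nor `q` has an arc, so a `T`-token
  -- has to dominate `a`.
  · obtain ⟨x, hx, hxa⟩ := dom a a rfl
    cases x with
    | T w =>
      simp only [Arc, if_true] at hxa
      rcases hxa with rfl | hxa
      · exact .inl hx
      · exact .inr ⟨w, hx, hxa.symm⟩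
    | S w => exact absurd rfl hxa.1
    | C c' => exact absurd rfl hxa.1.ne
    | q => exact absurd rfl hxa
    | X => exact hx.elim
    | pad => exact hx.elim
  -- The tokens of this set are on `T a` and `S b`, which have no arc to `X a b`, so only the
  -- control token is left.
  · obtain ⟨x, hx, hxa⟩ := dom a b hab
    cases x with
    | T w =>
      simp only [Arc, if_neg hne] at hxa
      exact absurd (htr.eq_of_mem hx ha hxa.1) hxa.2
    | S w => exact absurd (hsr.eq_of_mem hx hb hxa.2.1) hxa.2.2
    | C c' => rw [show c' = c from hx] at hxa; exact hxa
    | q => exact absurd hab hxa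
    | X => exact hx.elim
    | pad => exact hx.elim

lemma allowed_refl {t : Finset (Fin A.n)} (h : IsTokenDominatingSet A.G A.part t)
    (c : Fin (A.n + 2) × Fin (A.n + 2)) : Allowed t t c :=
  ⟨h, h.2, fun _ ha _ hb hab hne => absurd (IsTransversal.eq_of_mem h.2 ha hb hab) hne⟩

/-- The control value at the beginning. -/
def first (n : ℕ) : Fin (n + 2) × Fin (n + 2) := (⟨n, by omega⟩, ⟨n, by omega⟩)

/-- The control value at the end. -/
def last (n : ℕ) : Fin (n + 2) × Fin (n + 2) := (⟨n, by omega⟩, ⟨n + 1, by omega⟩)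

lemma not_hits_first {n : ℕ} (a b : Fin n) : ¬ Hits (first n) a b := by
  simp only [Hits, first]; omega

lemma not_hits_last {n : ℕ} (a b : Fin n) : ¬ Hits (last n) a b := by
  simp only [Hits, last]; omega

variable (A) in
/-- The reduction from token sliding to token jumping. -/
noncomputable def reduction : PartitionedDSInstance where
  n := size A.n
  k := 2 * A.k + 2
  G := newGraph A
  part := newPart A
  Dinit := place A.Dinit A.Dinit (first A.n)
  Dfin := place A.Dfin A.Dfin (last A.n)
  valid_init := (allowed_refl A.valid_init _).valid
  valid_fin := (allowed_refl A.valid_fin _).valid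

/-! ### Moves in the new instance -/

lemma move_reduction_iff {D D' : Finset (Fin (size A.n))} : (reduction A).Move .TJ D D' ↔
    ∃ v ∈ D, ∃ w ∉ D, newPart A v = newPart A w ∧ D' = insert w (D.erase v) :=
  ⟨fun ⟨v, hv, w, hw, h1, _, h2⟩ => ⟨v, hv, w, hw, h1, h2⟩,
    fun ⟨v, hv, w, hw, h1, h2⟩ => ⟨v, hv, w, hw, h1, fun h => by simp at h, h2⟩⟩

lemma insert_erase_iff {n : ℕ} {t : Finset (Fin n)} {x v w : Fin n} :
    x ∈ insert w (t.erase v) ↔ x = w ∨ x ≠ v ∧ x ∈ t := by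
  simp

lemma move_left {t t' s : Finset (Fin A.n)} {c : Fin (A.n + 2) × Fin (A.n + 2)}
    (h : A.Move .TJ t t') : (reduction A).Move .TJ (place t s c) (place t' s c) := by
  obtain ⟨v, hv, w, hw, hvw, -, rfl⟩ := h
  refine move_reduction_iff.2 ⟨enc (.T v), ?_, enc (.T w), ?_, ?_, ?_⟩
  · exact mem_place.2 (by rw [view_enc]; exact hv)
  · exact fun h' => hw (by rw [mem_place, view_enc] at h'; exact h')
  · exact Fin.ext (by simp [newPart, partIdx, hvw])
  · ext u
    rw [Finset.mem_insert, Finset.mem_erase]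
    simp only [mem_place, ne_eq, eq_enc_iff (x := .T v) (by simp),
      eq_enc_iff (x := .T w) (by simp)]
    cases view u <;> simp [Occupied]

lemma move_right {t s s' : Finset (Fin A.n)} {c : Fin (A.n + 2) × Fin (A.n + 2)}
    (h : A.Move .TJ s s') : (reduction A).Move .TJ (place t s c) (place t s' c) := by
  obtain ⟨v, hv, w, hw, hvw, -, rfl⟩ := h
  refine move_reduction_iff.2 ⟨enc (.S v), ?_, enc (.S w), ?_, ?_, ?_⟩
  · exact mem_place.2 (by rw [view_enc]; exact hv)
  · exact fun h' => hw (by rw [mem_place, view_enc] at h'; exact h')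
  · exact Fin.ext (by simp [newPart, partIdx, hvw])
  · ext u
    rw [Finset.mem_insert, Finset.mem_erase]
    simp only [mem_place, ne_eq, eq_enc_iff (x := .S v) (by simp),
      eq_enc_iff (x := .S w) (by simp)]
    cases view u <;> simp [Occupied]

lemma move_control {t s : Finset (Fin A.n)} {c c' : Fin (A.n + 2) × Fin (A.n + 2)}
    (h : c' ≠ c) : (reduction A).Move .TJ (place t s c) (place t s c') := by
  refine move_reduction_iff.2 ⟨enc (.C c), ?_, enc (.C c'), ?_, ?_, ?_⟩
  · exact mem_place.2 (by rw [view_enc]; rfl)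
  · exact fun h' => h (by rw [mem_place, view_enc] at h'; exact h')
  · exact Fin.ext (by simp [newPart, partIdx])
  · ext u
    rw [Finset.mem_insert, Finset.mem_erase]
    simp only [mem_place, ne_eq, eq_enc_iff (x := .C c) (by simp),
      eq_enc_iff (x := .C c') (by simp)]
    cases view u <;> simp [Occupied]

/-- A token set determines the kind of its tokens, except that `q` shares its set with constraints
and padding. These are empty in every `place`, so the token on `q` cannot move. -/
lemma move_cases {t s t' s' : Finset (Fin A.n)} {c c' : Fin (A.n + 2) × Fin (A.n + 2)}
    (h : (reduction A).Move .TJ (place t s c) (place t' s' c')) :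
    (A.Move .TJ t t' ∧ s' = s ∧ c' = c) ∨ (t' = t ∧ A.Move .TJ s s' ∧ c' = c) ∨
      (t' = t ∧ s' = s ∧ c' ≠ c) := by
  obtain ⟨v, hv, w, hw, hvw, he⟩ := move_reduction_iff.1 h
  have key : ∀ x, Occupied t' s' c' x ↔ (enc x = w ∨ enc x ≠ v ∧ Occupied t s c x) := by
    intro x
    have h1 := mem_place (t := t') (s := s') (c := c') (u := enc x)
    have h2 := mem_place (t := t) (s := s) (c := c) (u := enc x)
    rw [view_enc] at h1 h2
    rw [← h1, ← h2, he, Finset.mem_insert, Finset.mem_erase]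
  have hw' : Occupied t' s' c' (view w) := by
    rw [← mem_place, he]; exact Finset.mem_insert_self _ _
  rw [mem_place] at hv hw
  have hpv : view v ≠ .pad := fun h => by rw [h] at hv; exact hv
  have hpw : view w ≠ .pad := fun h => by rw [h] at hw'; exact hw'
  rw [← enc_view hpv, ← enc_view hpw] at key
  have enc_inj : ∀ x y : View A.n, enc x = enc y ↔ x = y := fun x y =>
    ⟨fun h => by rw [← view_enc x, h, view_enc], fun h => h ▸ rfl⟩
  simp only [ne_eq, enc_inj] at key
  have hvw' : partIdx A (view v) = partIdx A (view w) := congrArg Fin.val hvw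
  have kT := fun a => key (.T a)
  have kS := fun a => key (.S a)
  have kC := fun a => key (.C a)
  cases hv' : view v with
  | X => rw [hv'] at hv; exact hv.elim
  | pad => exact absurd hv' hpv
  | q =>
    rw [hv'] at hvw'
    cases hw'' : view w with
    | q => rw [hw''] at hw; exact absurd trivial hw
    | X => rw [hw''] at hw'; exact hw'.elim
    | pad => exact absurd hw'' hpw
    | _ => rw [hw''] at hvw'; simp only [partIdx] at hvw'; omega
  | T a =>
    rw [hv'] at hvw' hv
    cases hw'' : view w with
    | T b =>
      rw [hw''] at hvw' hw
      simp only [hv', hw''] at kT kS kC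
      simp [Occupied] at kT kS kC
      refine .inl ⟨⟨a, hv, b, hw, Fin.ext hvw', by simp, ?_⟩, Finset.ext kS, kC⟩
      ext x; rw [kT, insert_erase_iff]
    | S b => rw [hw''] at hvw'; simp only [partIdx] at hvw'; omega
    | _ => rw [hw''] at hvw'; simp only [partIdx] at hvw'; omega
  | S a =>
    rw [hv'] at hvw' hv
    cases hw'' : view w with
    | S b =>
      rw [hw''] at hvw' hw
      simp only [hv', hw''] at kT kS kC
      simp [Occupied] at kT kS kC
      refine .inr (.inl ⟨Finset.ext kT, ⟨a, hv, b, hw, Fin.ext ?_, by simp, ?_⟩, kC⟩)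
      · simpa [partIdx] using hvw'
      · ext x; rw [kS, insert_erase_iff]
    | T b => rw [hw''] at hvw'; simp only [partIdx] at hvw'; omega
    | _ => rw [hw''] at hvw'; simp only [partIdx] at hvw'; omega
  | C a =>
    rw [hv'] at hvw' hv
    cases hw'' : view w with
    | C b =>
      rw [hw''] at hw hw'
      simp only [hv', hw''] at kT kS
      simp [Occupied] at kT kS
      refine .inr (.inr ⟨Finset.ext kT, Finset.ext kS, ?_⟩)
      rintro rfl
      exact hw hw'
    | T b => rw [hw''] at hvw'; simp only [partIdx] at hvw'; omega
    | S b => rw [hw''] at hvw'; simp only [partIdx] at hvw'; omega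
    | _ => rw [hw''] at hvw'; simp only [partIdx] at hvw'; omega

/-! ### From sliding to jumping -/

lemma Move.toTJ {rule : TokenRule} {D D' : Finset (Fin A.n)} (h : A.Move rule D D') :
    A.Move .TJ D D' :=
  let ⟨v, hv, w, hw, h1, _, h3⟩ := h
  ⟨v, hv, w, hw, h1, by simp, h3⟩

/-- The copies disagree only in the token set of `v`, where the first copy is already on `w`, the
second still on `v`, and the control token names this edge. -/
lemma allowed_of_slide {D : Finset (Fin A.n)} {v w : Fin A.n}
    (hD : A.IsTransversal D) (hv : v ∈ D) (hvw : A.part v = A.part w) (hadj : A.G.Adj v w)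
    (hD' : IsTokenDominatingSet A.G A.part (insert w (D.erase v)))
    {c : Fin (A.n + 2) × Fin (A.n + 2)} (hc : Hits c v w) :
    Allowed (insert w (D.erase v)) D c := by
  refine ⟨hD', hD, fun a ha b hb hab hne => ?_⟩
  rcases insert_erase_iff.1 ha with rfl | ⟨-, ha⟩
  · obtain rfl := hD.eq_of_mem hb hv (hab.symm.trans hvw.symm)
    exact ⟨hadj.symm, hc.symm⟩
  · exact absurd (hD.eq_of_mem ha hb hab) hne

/-- A jump has to change the position, so the control value must differ from the next `(v, w)`.
Keeping its first coordinate off `D` guarantees this, and persists because after the slide that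
coordinate is the vertex just vacated. That `c` is not `last A.n` makes the concluding control jump
possible. -/
theorem reach_of_reach {ℓ : ℕ} {D : Finset (Fin A.n)} (h : A.Reach .TS ℓ D) :
    ∃ c, c ≠ last A.n ∧ (∀ v ∈ D, (c.1 : ℕ) ≠ v) ∧
      (reduction A).Reach .TJ (3 * ℓ) (place D D c) := by
  induction h with
  | start =>
    refine ⟨first A.n, by simp [first, last], fun v _ => ?_, .start⟩
    simp only [first]; omega
  | @step ℓ D D' h hm hD' ih =>
    obtain ⟨c, hc, hfresh, hr⟩ := ih
    have hTJ := Move.toTJ hm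
    obtain ⟨v, hv, w, hw, hvw, hadj, rfl⟩ := hm
    refine ⟨(Fin.castAdd 2 v, Fin.castAdd 2 w), ?_, ?_, ?_⟩
    · simp only [last, ne_eq, Prod.mk.injEq, Fin.ext_iff, Fin.val_castAdd]; omega
    · rintro x hx hxv
      obtain rfl : v = x := Fin.ext hxv
      rcases insert_erase_iff.1 hx with rfl | h'
      · exact hw hv
      · exact h'.1 rfl
    · have h1 := hr.step (move_control (c' := (Fin.castAdd 2 v, Fin.castAdd 2 w)) fun h' =>
        hfresh v hv (by rw [← h']; rfl)) (allowed_refl h.valid _).valid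
      have h2 := h1.step (move_left hTJ)
        (allowed_of_slide h.valid.2 hv hvw (hadj rfl) hD' (.inl ⟨rfl, rfl⟩)).valid
      exact h2.step (move_right hTJ) (allowed_refl hD' _).valid

theorem hasSeq_reduction {ℓ : ℕ} (h : A.HasSeq .TS ℓ) : (reduction A).HasSeq .TJ (3 * ℓ + 1) := by
  rw [hasSeq_iff_reach] at *
  obtain ⟨c, hc, -, hr⟩ := reach_of_reach h
  exact hr.step (move_control hc.symm) (allowed_refl A.valid_fin _).valid

/-! ### From jumping to sliding -/

/-- If `D` is dominating then it can be reached in time `b`, with three steps for each slide. -/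
def InTime (A : PartitionedDSInstance) (b : ℕ) (D : Finset (Fin A.n)) : Prop :=
  IsTokenDominatingSet A.G A.part D → ∃ ℓ, A.Reach .TS ℓ D ∧ 3 * ℓ ≤ b

lemma InTime.mono {b b' : ℕ} {D : Finset (Fin A.n)} (h : InTime A b D) (hb : b ≤ b') :
    InTime A b' D := fun hD =>
  let ⟨ℓ, h1, h2⟩ := h hD
  ⟨ℓ, h1, h2.trans hb⟩

/-- The set `D'` results from `D` by a slide along the edge that the control token selects. -/
def Slide (c : Fin (A.n + 2) × Fin (A.n + 2)) (D D' : Finset (Fin A.n)) : Prop :=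
  ∃ v ∈ D, ∃ w ∉ D, A.part v = A.part w ∧ A.G.Adj v w ∧ Hits c v w ∧ D' = insert w (D.erase v)

/-- The time bounds for a placement reached after `j` jumps. -/
structure Invariant (j : ℕ) (t s : Finset (Fin A.n)) (c : Fin (A.n + 2) × Fin (A.n + 2)) :
    Prop where
  left : InTime A (j + 1) t
  right : InTime A (j + 1) s
  idle : t = s → InTime A j t
  ends : t = s → c = last A.n → ∃ ℓ, A.Reach .TS ℓ t ∧ 3 * ℓ + 1 ≤ j
  slide : t = s → ∀ D, Slide c t D → InTime A (j + 2) D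

lemma IsTransversal.eq_of_subset {s t : Finset (Fin A.n)} (hs : A.IsTransversal s)
    (ht : A.IsTransversal t) (h : t ⊆ s) : t = s := by
  refine h.antisymm fun a ha => ?_
  obtain ⟨b, hb, hab⟩ := ht.exists_mem a
  rwa [← hs.eq_of_mem (h hb) ha hab]

/-- In each token set where the copies differ, the control value names the two vertices involved. By
`Hits.eq_or` a second such token set would yield the same pair, so the copies differ by one
exchange. -/
lemma Allowed.exists_of_ne {t s : Finset (Fin A.n)} {c : Fin (A.n + 2) × Fin (A.n + 2)}
    (h : Allowed t s c) (hne : t ≠ s) :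
    ∃ a b, a ∈ t ∧ a ∉ s ∧ b ∈ s ∧ b ∉ t ∧ Hits c a b ∧
      t = insert a (s.erase b) ∧ s = insert b (t.erase a) := by
  have ht : A.IsTransversal t := h.left.2
  have hs := h.right
  obtain ⟨a, ha, has⟩ : ∃ a ∈ t, a ∉ s := by
    by_contra! h'
    exact hne (IsTransversal.eq_of_subset hs ht h')
  obtain ⟨b, hb, hab⟩ := hs.exists_mem a
  have hne' : a ≠ b := fun h' => has (h' ▸ hb)
  have hbt : b ∉ t := fun h' => hne' (ht.eq_of_mem ha h' hab.symm)
  have hc := (h.edge a ha b hb hab.symm hne').2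
  -- If `x` were not in `s`, then `x` and its counterpart would be `a` and `b` in some order; but `x
  -- ≠ a`, and `b` is not in `t`.
  have mem_s : ∀ x ∈ t, x ≠ a → x ∈ s := fun x hx hxa => by
    obtain ⟨y, hy, hxy⟩ := hs.exists_mem x
    by_contra hxs
    rcases hc.eq_or (h.edge x hx y hy hxy.symm fun h' => hxs (h' ▸ hy)).2 with h' | h'
    · exact hxa h'.1
    · exact hbt (h'.1 ▸ hx)
  have mem_t : ∀ x ∈ s, x ≠ b → x ∈ t := fun x hx hxb => by
    obtain ⟨y, hy, hxy⟩ := ht.exists_mem x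
    by_contra hxt
    rcases hc.eq_or (h.edge y hy x hx hxy fun h' => hxt (h' ▸ hy)).2 with h' | h'
    · exact hxb h'.2
    · exact has (h'.2 ▸ hx)
  refine ⟨a, b, ha, has, hb, hbt, hc, Finset.ext fun x => ?_, Finset.ext fun x => ?_⟩
  · rw [insert_erase_iff]
    refine ⟨fun hx => ?_, ?_⟩
    · by_cases hxa : x = a
      · exact .inl hxa
      · exact .inr ⟨fun h' => hbt (h' ▸ hx), mem_s x hx hxa⟩
    · rintro (rfl | ⟨hxb, hx⟩)
      · exact ha
      · exact mem_t x hx hxb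
  · rw [insert_erase_iff]
    refine ⟨fun hx => ?_, ?_⟩
    · by_cases hxb : x = b
      · exact .inl hxb
      · exact .inr ⟨fun h' => has (h' ▸ hx), mem_t x hx hxb⟩
    · rintro (rfl | ⟨hxa, hx⟩)
      · exact hb
      · exact mem_s x hx hxa

/-- The deviating copy arises from `s` by the exchange along the named pair, and its direction is
fixed by which end lies in `s`. -/
lemma Allowed.left_unique {t t' s : Finset (Fin A.n)} {c : Fin (A.n + 2) × Fin (A.n + 2)}
    (h : Allowed t s c) (h' : Allowed t' s c) (hne : t ≠ s) (hne' : t' ≠ s) : t = t' := by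
  obtain ⟨a, b, -, has, hb, -, hc, ht, -⟩ := h.exists_of_ne hne
  obtain ⟨a', b', -, has', hb', -, hc', ht', -⟩ := h'.exists_of_ne hne'
  rcases hc.eq_or hc' with ⟨rfl, rfl⟩ | ⟨rfl, rfl⟩
  · rw [ht, ht']
  · exact absurd hb has'

lemma Allowed.right_unique {t s s' : Finset (Fin A.n)} {c : Fin (A.n + 2) × Fin (A.n + 2)}
    (h : Allowed t s c) (h' : Allowed t s' c) (hne : t ≠ s) (hne' : t ≠ s') : s = s' := by
  obtain ⟨a, b, ha, -, -, hbt, hc, -, hs⟩ := h.exists_of_ne hne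
  obtain ⟨a', b', ha', -, -, hbt', hc', -, hs'⟩ := h'.exists_of_ne hne'
  rcases hc.eq_or hc' with ⟨rfl, rfl⟩ | ⟨rfl, rfl⟩
  · rw [hs, hs']
  · exact absurd ha' hbt

/-- Only one end of the selected edge lies in `s`, so sliding along it is possible in one direction
only, the one that leads to `t`. -/
lemma Slide.eq_left {t s D : Finset (Fin A.n)} {c : Fin (A.n + 2) × Fin (A.n + 2)}
    (h : Allowed t s c) (hne : t ≠ s) (hD : Slide c s D) : D = t := by
  obtain ⟨a, b, -, has, hb, -, hc, ht, -⟩ := h.exists_of_ne hne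
  obtain ⟨v, hv, w, hw, -, -, hc', rfl⟩ := hD
  rcases hc.eq_or hc' with ⟨rfl, rfl⟩ | ⟨rfl, rfl⟩
  · exact absurd hv has
  · exact ht.symm

lemma Slide.eq_right {t s D : Finset (Fin A.n)} {c : Fin (A.n + 2) × Fin (A.n + 2)}
    (h : Allowed t s c) (hne : t ≠ s) (hD : Slide c t D) : D = s := by
  obtain ⟨a, b, ha, -, -, hbt, hc, -, hs⟩ := h.exists_of_ne hne
  obtain ⟨v, hv, w, hw, -, -, hc', rfl⟩ := hD
  rcases hc.eq_or hc' with ⟨rfl, rfl⟩ | ⟨rfl, rfl⟩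
  · exact hs.symm
  · exact absurd hv hbt

lemma Move.ne {rule : TokenRule} {D D' : Finset (Fin A.n)} (h : A.Move rule D D') : D' ≠ D := by
  obtain ⟨v, hv, w, hw, -, -, rfl⟩ := h
  exact fun h => hw (h ▸ Finset.mem_insert_self _ _)

lemma Allowed.ne_last {t s : Finset (Fin A.n)} {c : Fin (A.n + 2) × Fin (A.n + 2)}
    (h : Allowed t s c) (hne : t ≠ s) : c ≠ last A.n := by
  rintro rfl
  obtain ⟨a, b, -, -, -, -, hc, -⟩ := h.exists_of_ne hne
  exact not_hits_last a b hc

/-- By `Allowed.left_unique`, a jump in the first copy either departs from `t = s` or restores it.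
Departing uses the bound `j + 2` for the selected slide as the bound one above the new time;
restoring uses the bound `j + 1` as the idle bound. -/
lemma Invariant.step_left {j : ℕ} {t t' s : Finset (Fin A.n)}
    {c : Fin (A.n + 2) × Fin (A.n + 2)} (hi : Invariant j t s c) (h : Allowed t s c)
    (h' : Allowed t' s c) (hm : A.Move .TJ t t') : Invariant (j + 1) t' s c := by
  by_cases hts : t = s
  · subst hts
    have hne := Move.ne hm
    refine ⟨hi.slide rfl t' ?_, hi.right.mono (by omega), fun e => absurd e hne,
      fun e => absurd e hne, fun e => absurd e hne⟩
    obtain ⟨v, hv, w, hw, hvw, -, rfl⟩ := hm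
    -- Since the new placement is allowed, the jump is a slide along the edge that the control token
    -- selects.
    obtain ⟨h1, h2⟩ := h'.edge w (Finset.mem_insert_self _ _) v hv hvw.symm
      (fun e => hw (e ▸ hv))
    exact ⟨v, hv, w, hw, hvw, h1.symm, h2.symm, rfl⟩
  · have ht' : t' = s := by
      by_contra hne
      exact Move.ne hm (h'.left_unique h hne hts)
    subst ht'
    -- With the control token unmoved, the only slide it permits leads back to the old `t`, whose
    -- bound is already known.
    refine ⟨hi.right.mono (by omega), hi.right.mono (by omega), fun _ => hi.right,
      fun _ e => absurd e (h.ne_last hts), fun _ D hD => ?_⟩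
    rw [Slide.eq_left h hts hD]
    exact hi.left.mono (by omega)

/-- The mirror image of `Invariant.step_left`. If the second copy moves first, `s'` need not be
dominating, which is why `InTime` is conditional. -/
lemma Invariant.step_right {j : ℕ} {t s s' : Finset (Fin A.n)}
    {c : Fin (A.n + 2) × Fin (A.n + 2)} (hi : Invariant j t s c) (h : Allowed t s c)
    (h' : Allowed t s' c) (hm : A.Move .TJ s s') : Invariant (j + 1) t s' c := by
  by_cases hts : t = s
  · subst hts
    have hne := (Move.ne hm).symm
    refine ⟨hi.left.mono (by omega), hi.slide rfl s' ?_, fun e => absurd e hne,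
      fun e => absurd e hne, fun e => absurd e hne⟩
    obtain ⟨v, hv, w, hw, hvw, -, rfl⟩ := hm
    obtain ⟨h1, h2⟩ := h'.edge v hv w (Finset.mem_insert_self _ _) hvw (fun e => hw (e ▸ hv))
    exact ⟨v, hv, w, hw, hvw, h1, h2, rfl⟩
  · have hs' : t = s' := by
      by_contra hne
      exact Move.ne hm (h'.right_unique h hne hts)
    subst hs'
    refine ⟨hi.left.mono (by omega), hi.left.mono (by omega), fun _ => hi.left,
      fun _ e => absurd e (h.ne_last hts), fun _ D hD => ?_⟩
    rw [Slide.eq_right h hts hD]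
    exact hi.right.mono (by omega)

/-- New slides open up only here, and only with `t = s`. From `3 * ℓ ≤ j` one gets `3 * (ℓ + 1) ≤ (j
+ 1) + 2`, the bound demanded for a selected slide. The same jump pays for the extra `1` in `ends`.
-/
lemma Invariant.step_control {j : ℕ} {t s : Finset (Fin A.n)}
    {c c' : Fin (A.n + 2) × Fin (A.n + 2)} (hi : Invariant j t s c) (h : Allowed t s c) :
    Invariant (j + 1) t s c' := by
  refine ⟨hi.left.mono (by omega), hi.right.mono (by omega), fun e => (hi.idle e).mono (by omega),
    fun e _ => ?_, fun e D hD hv => ?_⟩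
  · obtain ⟨ℓ, h1, h2⟩ := hi.idle e h.left
    exact ⟨ℓ, h1, by omega⟩
  · obtain ⟨ℓ, h1, h2⟩ := hi.idle e h.left
    obtain ⟨v, hv', w, hw, hvw, hadj, -, hD'⟩ := hD
    exact ⟨ℓ + 1, h1.step ⟨v, hv', w, hw, hvw, fun _ => hadj, hD'⟩ hv, by omega⟩

theorem exists_invariant {j : ℕ} {D : Finset (Fin (reduction A).n)}
    (h : (reduction A).Reach .TJ j D) :
    ∃ t s c, D = place t s c ∧ Allowed t s c ∧ Invariant j t s c := by
  induction h with
  | start =>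
    have h0 : InTime A 0 A.Dinit := fun _ => ⟨0, .start, le_rfl⟩
    refine ⟨A.Dinit, A.Dinit, first A.n, rfl, allowed_refl A.valid_init _,
      -- At the start the control value is neither final nor the name of a pair, so `ends` and
      -- `slide` are vacuous.
      h0.mono (by omega), h0.mono (by omega), fun _ => h0, fun _ e => ?_, fun _ D hD => ?_⟩
    · simp [first, last] at e
    · obtain ⟨v, -, w, -, -, -, hc, -⟩ := hD
      exact absurd hc (not_hits_first v w)
  | @step j D D' h hm hD' ih =>
    obtain ⟨t, s, c, rfl, hal, hi⟩ := ih
    obtain ⟨t', s', c', rfl, hal'⟩ := exists_allowed hD'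
    refine ⟨t', s', c', rfl, hal', ?_⟩
    rcases move_cases hm with ⟨hm', rfl, rfl⟩ | ⟨rfl, hm', rfl⟩ | ⟨rfl, rfl, -⟩
    · exact hi.step_left hal hal' hm'
    · exact hi.step_right hal hal' hm'
    · exact hi.step_control hal

/-- The final placement has equal copies and control value `last A.n`, so the field `ends` applies.
-/
theorem hasSeq_of_reduction {m : ℕ} (h : (reduction A).HasSeq .TJ m) :
    ∃ ℓ, A.HasSeq .TS ℓ ∧ 3 * ℓ + 1 ≤ m := by
  rw [hasSeq_iff_reach] at h
  obtain ⟨t, s, c, he, -, hi⟩ := exists_invariant h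
  obtain ⟨rfl, rfl, rfl⟩ := place_inj (show place A.Dfin A.Dfin (last A.n) = place t s c from he)
  obtain ⟨ℓ, h1, h2⟩ := hi.ends rfl rfl
  exact ⟨ℓ, hasSeq_iff_reach.2 h1, h2⟩

end SlideToJump

/-! ### The encoding of instances -/

namespace SlideToJump

open PartitionedDSInstance RAM

/-! ### Positions in flattened lists and unary prefixes -/

section Lists

lemma flatMap_finRange_eq {α : Type*} {n : ℕ} {f : Fin n → List α} {g : ℕ → List α}
    (h : ∀ i : Fin n, f i = g i) : (List.finRange n).flatMap f = (List.range n).flatMap g := by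
  rw [← List.map_coe_finRange_eq_range, List.flatMap_map]
  exact List.flatMap_congr fun i _ => h i

lemma map_finRange_eq {α : Type*} {n : ℕ} {f : Fin n → α} {g : ℕ → List α}
    (h : ∀ i : Fin n, [f i] = g i) : (List.finRange n).map f = (List.range n).flatMap g := by
  rw [List.map_eq_flatMap]
  exact flatMap_finRange_eq h

lemma replicate_eq_flatMap {α : Type*} (n : ℕ) (a : α) :
    List.replicate n a = (List.range n).flatMap fun _ => [a] := by
  rw [← List.map_eq_flatMap]
  simp

lemma onesFrom_append (l : List Bool) (m : ℕ) (l' : List Bool) :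
    onesFrom (l ++ (List.replicate m true ++ false :: l')) l.length = m := by
  unfold onesFrom
  rw [List.drop_left]
  induction m with
  | zero => simp
  | succ m ih => simp_all [List.replicate_succ]

lemma length_flatMap_finRange {α : Type*} {m p : ℕ} (f : Fin m → Fin p → α) :
    ((List.finRange m).flatMap fun u => (List.finRange p).map (f u)).length = m * p := by
  simp [List.length_flatMap]

lemma getElem?_flatMap_finRange {α : Type*} {m p : ℕ} (f : Fin m → Fin p → α) (u : Fin m)
    (v : Fin p) :
    ((List.finRange m).flatMap fun u => (List.finRange p).map (f u))[(u : ℕ) * p + v]? =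
      some (f u v) := by
  induction m with
  | zero => exact u.elim0
  | succ m ih =>
    rw [List.finRange_succ, List.flatMap_cons, List.flatMap_map]
    refine Fin.cases ?_ (fun u => ?_) u
    · rw [List.getElem?_append_left (by simp)]
      simp
    · rw [List.getElem?_append_right (by simp [Nat.succ_mul]; omega)]
      have h := ih (fun u => f u.succ) u
      rw [← h]
      congr 1
      simp [Nat.succ_mul]; omega

end Lists

variable (A : PartitionedDSInstance)

lemma onesFrom_code_zero : onesFrom A.code 0 = A.n := by
  unfold PartitionedDSInstance.code
  simp only [List.append_assoc, List.cons_append, List.nil_append]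
  exact onesFrom_append [] _ _

lemma onesFrom_code_succ : onesFrom A.code (A.n + 1) = A.k := by
  unfold PartitionedDSInstance.code
  simp only [List.append_assoc]
  have h := onesFrom_append (List.replicate A.n true ++ [false]) A.k
  simp only [List.length_append, List.length_replicate, List.length_singleton,
    List.append_assoc] at h
  exact h _

lemma bitAt_eq {x : List Bool} {p : ℕ} {P : Prop} [Decidable P] (h : x[p]? = some (decide P)) :
    bitAt x p ≠ 0 ↔ P := by
  unfold bitAt
  rw [h]
  by_cases hP : P <;> simp [hP]

/-- The position in the code where the adjacency matrix starts. -/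
def adjPos (n k : ℕ) : ℕ := n + k + 2

/-- The position in the code where the incidence matrix starts. -/
def partPos (n k : ℕ) : ℕ := adjPos n k + n * n

/-- The position in the code where the initial dominating set starts. -/
def initPos (n k : ℕ) : ℕ := partPos n k + n * k

/-- The position in the code where the final dominating set starts. -/
def finPos (n k : ℕ) : ℕ := initPos n k + n

/-- The two unary numbers with their terminators fill `n + k + 2` positions, and row `u` starts at
offset `u * n` after them. -/
lemma adj_bit (u v : Fin A.n) :
    bitAt A.code (adjPos A.n A.k + (u * A.n + v)) ≠ 0 ↔ A.G.Adj u v := by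
  classical
  have h := getElem?_flatMap_finRange (fun u v => decide (A.G.Adj u v)) u v
  have hlt := (List.getElem?_eq_some_iff.1 h).1
  rw [length_flatMap_finRange] at hlt
  apply bitAt_eq
  unfold PartitionedDSInstance.code
  rw [List.getElem?_append_left, List.getElem?_append_left, List.getElem?_append_left,
    List.getElem?_append_right]
  all_goals simp only [List.length_append, List.length_replicate, List.length_singleton,
    length_flatMap_finRange, List.length_map, List.length_finRange, adjPos]
  · rw [show A.n + A.k + 2 + (u * A.n + v) - (A.n + 1 + A.k + 1) = u * A.n + v by omega]
    convert h
  all_goals omega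

lemma part_bit (v : Fin A.n) (i : Fin A.k) :
    bitAt A.code (partPos A.n A.k + (v * A.k + i)) ≠ 0 ↔ A.part v = i := by
  classical
  have h := getElem?_flatMap_finRange (fun v i => decide (A.part v = i)) v i
  have hlt := (List.getElem?_eq_some_iff.1 h).1
  rw [length_flatMap_finRange] at hlt
  apply bitAt_eq
  unfold PartitionedDSInstance.code
  rw [List.getElem?_append_left, List.getElem?_append_left, List.getElem?_append_right]
  all_goals simp only [List.length_append, List.length_replicate, List.length_singleton,
    length_flatMap_finRange, List.length_map, List.length_finRange, partPos, adjPos]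
  · rw [show A.n + A.k + 2 + A.n * A.n + (v * A.k + i) - (A.n + 1 + A.k + 1 + A.n * A.n) =
      v * A.k + i by omega]
    convert h
  all_goals omega

lemma init_bit (v : Fin A.n) : bitAt A.code (initPos A.n A.k + v) ≠ 0 ↔ v ∈ A.Dinit := by
  classical
  apply bitAt_eq
  unfold PartitionedDSInstance.code
  rw [List.getElem?_append_left, List.getElem?_append_right]
  all_goals simp only [List.length_append, List.length_replicate, List.length_singleton,
    length_flatMap_finRange, List.length_map, List.length_finRange, initPos, partPos, adjPos]
  · rw [show A.n + A.k + 2 + A.n * A.n + A.n * A.k + v -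
      (A.n + 1 + A.k + 1 + A.n * A.n + A.n * A.k) = (v : ℕ) by omega]
    simp
  · omega
  · omega

lemma fin_bit (v : Fin A.n) : bitAt A.code (finPos A.n A.k + v) ≠ 0 ↔ v ∈ A.Dfin := by
  classical
  apply bitAt_eq
  unfold PartitionedDSInstance.code
  rw [List.getElem?_append_right]
  all_goals simp only [List.length_append, List.length_replicate, List.length_singleton,
    length_flatMap_finRange, List.length_map, List.length_finRange, finPos, initPos, partPos,
    adjPos]
  · rw [show A.n + A.k + 2 + A.n * A.n + A.n * A.k + A.n + v -
      (A.n + 1 + A.k + 1 + A.n * A.n + A.n * A.k + A.n) = (v : ℕ) by omega]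
    simp
  · omega

/-! ### The program of the reduction -/

/-! ### Recognising the kind of a vertex from its digits -/

section Digits

variable {n : ℕ} {u : Fin (size n)}

lemma view_eq_T {a : Fin n} : view u = .T a ↔
    u / (n + 2) / (n + 2) = 2 ∧ u % (n + 2) = 0 ∧ u / (n + 2) % (n + 2) = a := by
  obtain ⟨τ, c, b, hτ, hc, hb, rfl⟩ := exists_number u
  rw [view_number]
  simp only [number, (digits hb).1, (digits hb).2, (digits hc).1, (digits hc).2, decode]
  split_ifs <;> simp [Fin.ext_iff] <;> omega

lemma view_eq_S {a : Fin n} : view u = .S a ↔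
    u / (n + 2) / (n + 2) = 2 ∧ u % (n + 2) = 1 ∧ u / (n + 2) % (n + 2) = a := by
  obtain ⟨τ, c, b, hτ, hc, hb, rfl⟩ := exists_number u
  rw [view_number]
  simp only [number, (digits hb).1, (digits hb).2, (digits hc).1, (digits hc).2, decode]
  split_ifs <;> simp [Fin.ext_iff] <;> omega

lemma view_eq_C {c : Fin (n + 2) × Fin (n + 2)} : view u = .C c ↔
    u / (n + 2) / (n + 2) = 1 ∧ u / (n + 2) % (n + 2) = c.1 ∧ u % (n + 2) = c.2 := by
  obtain ⟨τ, a, b, hτ, ha, hb, rfl⟩ := exists_number u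
  rw [view_number]
  simp only [number, (digits hb).1, (digits hb).2, (digits ha).1, (digits ha).2, decode]
  split_ifs <;> simp [Fin.ext_iff, Prod.ext_iff, Nat.mod_eq_of_lt ha, Nat.mod_eq_of_lt hb] <;> omega

lemma view_eq_X {a b : Fin n} : view u = .X a b ↔
    u / (n + 2) / (n + 2) = 0 ∧ u / (n + 2) % (n + 2) = a ∧ u % (n + 2) = b := by
  obtain ⟨τ, c, d, hτ, hc, hd, rfl⟩ := exists_number u
  rw [view_number]
  simp only [number, (digits hd).1, (digits hd).2, (digits hc).1, (digits hc).2, decode]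
  split_ifs <;> simp [Fin.ext_iff] <;> omega

lemma view_eq_q : view u = .q ↔
    u / (n + 2) / (n + 2) = 2 ∧ u % (n + 2) = 0 ∧ u / (n + 2) % (n + 2) = n := by
  obtain ⟨τ, c, b, hτ, hc, hb, rfl⟩ := exists_number u
  rw [view_number]
  simp only [number, (digits hb).1, (digits hb).2, (digits hc).1, (digits hc).2, decode]
  split_ifs <;> simp <;> omega

end Digits

/-! ### Arithmetic expressions for the bits of the new code -/

section Expressions

/-- Sum. For truth values, where nonzero means true, this is the disjunction. -/
def eAdd (a b : Expr) : Expr := .op .add a b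
/-- Truncated difference. For truth values, `eSub b a` means that `a` is less than `b`. -/
def eSub (a b : Expr) : Expr := .op .sub a b
/-- Product. For truth values, this is the conjunction. -/
def eMul (a b : Expr) : Expr := .op .mul a b
/-- Quotient. -/
def eDiv (a b : Expr) : Expr := .op .div a b
/-- Remainder. -/
def eMod (a b : Expr) : Expr := eSub a (eMul (eDiv a b) b)
/-- Negation. -/
def eNot (a : Expr) : Expr := eSub (.const 1) a
/-- Equality. -/
def eEq (a b : Expr) : Expr := eNot (eAdd (eSub a b) (eSub b a))

variable {x : List Bool} {v : ℕ → ℕ} {a b : Expr}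

lemma eval_eAdd : (eAdd a b).eval x v = a.eval x v + b.eval x v := rfl
lemma eval_eSub : (eSub a b).eval x v = a.eval x v - b.eval x v := rfl
lemma eval_eMul : (eMul a b).eval x v = a.eval x v * b.eval x v := rfl
lemma eval_eDiv : (eDiv a b).eval x v = a.eval x v / b.eval x v := rfl

lemma eval_eMod : (eMod a b).eval x v = a.eval x v % b.eval x v := by
  rw [eMod, eval_eSub, eval_eMul, eval_eDiv]
  have := Nat.div_add_mod' (a.eval x v) (b.eval x v)
  omega

/-- The truth value of an expression. -/
def Holds (x : List Bool) (a : Expr) (v : ℕ → ℕ) : Prop := a.eval x v ≠ 0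

lemma holds_or : Holds x (eAdd a b) v ↔ Holds x a v ∨ Holds x b v := by
  simp only [Holds, eval_eAdd]; omega

lemma holds_and : Holds x (eMul a b) v ↔ Holds x a v ∧ Holds x b v := by
  simp [Holds, eval_eMul]

lemma holds_not : Holds x (eNot a) v ↔ ¬ Holds x a v := by
  simp only [Holds, eNot, eSub, Expr.eval, Op.eval]; omega

lemma holds_eq : Holds x (eEq a b) v ↔ a.eval x v = b.eval x v := by
  simp only [Holds, eEq, eAdd, eNot, eSub, Expr.eval, Op.eval]; omega

lemma holds_lt : Holds x (eSub b a) v ↔ a.eval x v < b.eval x v := by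
  simp only [Holds, eval_eSub]; omega

/-- The number of vertices. -/
def nE : Expr := .scan (.const 0)
/-- The number of token sets. -/
def kE : Expr := .scan (eAdd nE (.const 1))
/-- The base of the digits. -/
def mE : Expr := eAdd nE (.const 2)
/-- The number of new vertices. -/
def sizeE : Expr := eMul (eMul (.const 3) mE) mE
/-- The number of new token sets. -/
def newKE : Expr := eAdd (eMul (.const 2) kE) (.const 2)
/-- See `adjPos`. -/
def adjPosE : Expr := eAdd (eAdd nE kE) (.const 2)
/-- See `partPos`. -/
def partPosE : Expr := eAdd adjPosE (eMul nE nE)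
/-- See `initPos`. -/
def initPosE : Expr := eAdd partPosE (eMul nE kE)
/-- See `finPos`. -/
def finPosE : Expr := eAdd initPosE nE
/-- Adjacency in the old graph. -/
def adjE (a b : Expr) : Expr := .read (eAdd adjPosE (eAdd (eMul a nE) b))
/-- Incidence of vertices and token sets. -/
def partE (a i : Expr) : Expr := .read (eAdd partPosE (eAdd (eMul a kE) i))
/-- Two vertices, given by expressions that do not use the variable `0`, are in the same token
set. -/
def sameE (a b : Expr) : Expr := .sum kE (eMul (partE a (.var 0)) (partE b (.var 0)))
/-- The leading digit of variable `j`. -/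
def dig₁ (j : ℕ) : Expr := eDiv (eDiv (.var j) mE) mE
/-- The second digit of variable `j`. -/
def dig₂ (j : ℕ) : Expr := eMod (eDiv (.var j) mE) mE
/-- The last digit of variable `j`. -/
def dig₃ (j : ℕ) : Expr := eMod (.var j) mE

/-- Variable `j` is of kind `T`. -/
def isT (j : ℕ) : Expr :=
  eMul (eEq (dig₁ j) (.const 2)) (eMul (eEq (dig₃ j) (.const 0)) (eSub nE (dig₂ j)))
/-- Variable `j` is of kind `S`. -/
def isS (j : ℕ) : Expr :=
  eMul (eEq (dig₁ j) (.const 2)) (eMul (eEq (dig₃ j) (.const 1)) (eSub nE (dig₂ j)))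
/-- Variable `j` is of kind `C`. -/
def isC (j : ℕ) : Expr := eEq (dig₁ j) (.const 1)
/-- Variable `j` is of kind `X`. -/
def isX (j : ℕ) : Expr :=
  eMul (eEq (dig₁ j) (.const 0)) (eMul (eSub nE (dig₂ j)) (eSub nE (dig₃ j)))
/-- Variable `j` is of kind `q`. -/
def isQ (j : ℕ) : Expr :=
  eMul (eEq (dig₁ j) (.const 2)) (eMul (eEq (dig₃ j) (.const 0)) (eEq (dig₂ j) nE))

/-- See `Arc`. -/
def arcE (i j : ℕ) : Expr :=
  eAdd (eMul (isQ i) (eMul (eNot (isQ j)) (eNot (eMul (isX j)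
    (sameE (dig₂ (j + 1)) (dig₃ (j + 1))))))) <|
  eAdd (eMul (isT i) (eMul (isX j) (eAdd
    (eMul (eEq (dig₂ j) (dig₃ j)) (eAdd (eEq (dig₂ i) (dig₂ j)) (adjE (dig₂ i) (dig₂ j))))
    (eMul (eNot (eEq (dig₂ j) (dig₃ j))) (eMul (sameE (dig₂ (i + 1)) (dig₂ (j + 1)))
      (eNot (eEq (dig₂ i) (dig₂ j)))))))) <|
  eAdd (eMul (isS i) (eMul (isX j) (eMul (eNot (eEq (dig₂ j) (dig₃ j)))
    (eMul (sameE (dig₂ (i + 1)) (dig₃ (j + 1))) (eNot (eEq (dig₂ i) (dig₃ j)))))))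
  (eMul (isC i) (eMul (isX j) (eMul (adjE (dig₂ j) (dig₃ j)) (eAdd
    (eMul (eEq (dig₂ i) (dig₂ j)) (eEq (dig₃ i) (dig₃ j)))
    (eMul (eEq (dig₂ i) (dig₃ j)) (eEq (dig₃ i) (dig₂ j)))))))

/-- Vertex `1` is in token set `0`. -/
def newPartE : Expr :=
  eAdd (eMul (isT 1) (eMul (eSub kE (.var 0)) (partE (dig₂ 1) (.var 0)))) <|
  eAdd (eMul (isS 1) (eMul (eNot (eSub kE (.var 0))) (eMul (eSub (eAdd kE kE) (.var 0))
    (partE (dig₂ 1) (eSub (.var 0) kE))))) <|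
  eAdd (eMul (isC 1) (eEq (.var 0) (eAdd kE kE)))
  (eMul (eNot (isT 1)) (eMul (eNot (isS 1)) (eMul (eNot (isC 1))
    (eEq (.var 0) (eAdd (eAdd kE kE) (.const 1))))))

/-- See `place`; `p` is the position of the old token set and `e` the last digit of the control
value. -/
def placeE (p e : Expr) : Expr :=
  eAdd (eMul (isT 0) (.read (eAdd p (dig₂ 0)))) <|
  eAdd (eMul (isS 0) (.read (eAdd p (dig₂ 0)))) <|
  eAdd (eMul (isC 0) (eMul (eEq (dig₂ 0) nE) (eEq (dig₃ 0) e))) (isQ 0)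

/-- The program that writes the code of the new instance. -/
def codeGen : Gen :=
  .seq (.seq (.seq (.seq (.seq (.seq (.seq
    (.iter sizeE (.bit (.const 1))) (.bit (.const 0)))
    (.iter newKE (.bit (.const 1)))) (.bit (.const 0)))
    (.iter sizeE (.iter sizeE (.bit (eAdd (arcE 1 0) (arcE 0 1))))))
    (.iter sizeE (.iter newKE (.bit newPartE))))
    (.iter sizeE (.bit (placeE initPosE nE))))
    (.iter sizeE (.bit (placeE finPosE (eAdd nE (.const 1)))))

end Expressions

/-! ### Correctness of the expressions -/

section Correctness

variable {A} {v : ℕ → ℕ}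

@[simp] lemma eval_nE : nE.eval A.code v = A.n := onesFrom_code_zero A

@[simp] lemma eval_kE : kE.eval A.code v = A.k := by
  unfold kE
  rw [Expr.eval, eval_eAdd, eval_nE]
  exact onesFrom_code_succ A

@[simp] lemma eval_mE : mE.eval A.code v = A.n + 2 := by
  rw [mE, eval_eAdd, eval_nE]; rfl

lemma eval_sizeE : sizeE.eval A.code v = size A.n := by
  rw [sizeE, eval_eMul, eval_eMul, eval_mE]; rfl

lemma eval_newKE : newKE.eval A.code v = 2 * A.k + 2 := by
  rw [newKE, eval_eAdd, eval_eMul, eval_kE]; rfl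

lemma eval_adjPosE : adjPosE.eval A.code v = adjPos A.n A.k := by
  rw [adjPosE, eval_eAdd, eval_eAdd, eval_nE, eval_kE]; rfl

lemma eval_partPosE : partPosE.eval A.code v = partPos A.n A.k := by
  rw [partPosE, eval_eAdd, eval_eMul, eval_adjPosE, eval_nE]; rfl

lemma eval_initPosE : initPosE.eval A.code v = initPos A.n A.k := by
  rw [initPosE, eval_eAdd, eval_eMul, eval_partPosE, eval_nE, eval_kE]; rfl

lemma eval_finPosE : finPosE.eval A.code v = finPos A.n A.k := by
  rw [finPosE, eval_eAdd, eval_initPosE, eval_nE]; rfl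

@[simp] lemma eval_dig₁ (j : ℕ) :
    (dig₁ j).eval A.code v = v j / (A.n + 2) / (A.n + 2) := by
  rw [dig₁, eval_eDiv, eval_eDiv, eval_mE]; rfl

@[simp] lemma eval_dig₂ (j : ℕ) :
    (dig₂ j).eval A.code v = v j / (A.n + 2) % (A.n + 2) := by
  rw [dig₂, eval_eMod, eval_eDiv, eval_mE]; rfl

@[simp] lemma eval_dig₃ (j : ℕ) : (dig₃ j).eval A.code v = v j % (A.n + 2) := by
  rw [dig₃, eval_eMod, eval_mE]; rfl

lemma holds_adjE {a b : Expr} {a' b' : Fin A.n} (ha : a.eval A.code v = a')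
    (hb : b.eval A.code v = b') : Holds A.code (adjE a b) v ↔ A.G.Adj a' b' := by
  rw [← adj_bit, Holds, adjE, Expr.eval, eval_eAdd, eval_eAdd, eval_eMul, eval_adjPosE, eval_nE,
    ha, hb]

lemma holds_partE {a i : Expr} {a' : Fin A.n} {i' : Fin A.k} (ha : a.eval A.code v = a')
    (hi : i.eval A.code v = i') : Holds A.code (partE a i) v ↔ A.part a' = i' := by
  rw [← part_bit, Holds, partE, Expr.eval, eval_eAdd, eval_eAdd, eval_eMul, eval_partPosE,
    eval_kE, ha, hi]

/-- The sum counts the token sets that contain both vertices. Since it binds a new variable `0`, the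
hypotheses concern the extended environments. -/
lemma holds_sameE {a b : Expr} {a' b' : Fin A.n} (ha : ∀ i, a.eval A.code (push i v) = a')
    (hb : ∀ i, b.eval A.code (push i v) = b') :
    Holds A.code (sameE a b) v ↔ A.part a' = A.part b' := by
  have key : ∀ i : Fin A.k, Holds A.code (eMul (partE a (.var 0)) (partE b (.var 0))) (push i v) ↔
      A.part a' = i ∧ A.part b' = i := fun i => by
    rw [holds_and, holds_partE (i' := i) (ha i) rfl, holds_partE (i' := i) (hb i) rfl]
  rw [Holds, sameE, Expr.eval, eval_kE, ne_eq, Finset.sum_eq_zero_iff]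
  push Not
  constructor
  · rintro ⟨i, hi, h⟩
    obtain ⟨h1, h2⟩ := (key ⟨i, Finset.mem_range.1 hi⟩).1 h
    rw [h1, h2]
  · intro h
    exact ⟨A.part a', by simp, (key _).2 ⟨rfl, h.symm⟩⟩

section Kinds

variable {j : ℕ} {u : Fin (size A.n)}

lemma holds_isT (hj : v j = u) : Holds A.code (isT j) v ↔ ∃ a, view u = .T a := by
  simp only [isT, holds_and, holds_eq, holds_lt, eval_dig₁, eval_dig₂, eval_dig₃, eval_nE,
    Expr.eval, hj, view_eq_T]
  exact ⟨fun h => ⟨⟨_, h.2.2⟩, h.1, h.2.1, rfl⟩, fun ⟨a, h1, h2, h3⟩ => ⟨h1, h2, h3 ▸ a.2⟩⟩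

lemma holds_isS (hj : v j = u) : Holds A.code (isS j) v ↔ ∃ a, view u = .S a := by
  simp only [isS, holds_and, holds_eq, holds_lt, eval_dig₁, eval_dig₂, eval_dig₃, eval_nE,
    Expr.eval, hj, view_eq_S]
  exact ⟨fun h => ⟨⟨_, h.2.2⟩, h.1, h.2.1, rfl⟩, fun ⟨a, h1, h2, h3⟩ => ⟨h1, h2, h3 ▸ a.2⟩⟩

lemma holds_isC (hj : v j = u) : Holds A.code (isC j) v ↔ ∃ c, view u = .C c := by
  simp only [isC, holds_eq, eval_dig₁, Expr.eval, hj, view_eq_C]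
  exact ⟨fun h => ⟨(⟨_, Nat.mod_lt _ (by omega)⟩, ⟨_, Nat.mod_lt _ (by omega)⟩), h, rfl, rfl⟩,
    fun ⟨_, h, _⟩ => h⟩

lemma holds_isX (hj : v j = u) : Holds A.code (isX j) v ↔ ∃ a b, view u = .X a b := by
  simp only [isX, holds_and, holds_eq, holds_lt, eval_dig₁, eval_dig₂, eval_dig₃, eval_nE,
    Expr.eval, hj, view_eq_X]
  exact ⟨fun h => ⟨⟨_, h.2.1⟩, ⟨_, h.2.2⟩, h.1, rfl, rfl⟩,
    fun ⟨a, b, h1, h2, h3⟩ => ⟨h1, h2 ▸ a.2, h3 ▸ b.2⟩⟩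

lemma holds_isQ (hj : v j = u) : Holds A.code (isQ j) v ↔ view u = .q := by
  simp only [isQ, holds_and, holds_eq, eval_dig₁, eval_dig₂, eval_dig₃, eval_nE, Expr.eval, hj,
    view_eq_q]

end Kinds

/-- The case distinction is by kind. Inside `sameE` the variables are shifted by one because of the
bound variable, so the digits are evaluated in `push` environments as well. -/
lemma holds_arcE {i j : ℕ} {u w : Fin (size A.n)} (hi : v i = u) (hj : v j = w) :
    Holds A.code (arcE i j) v ↔ Arc A (view u) (view w) := by
  simp only [arcE, holds_or, holds_and, holds_not, holds_eq, holds_isT hi, holds_isS hi,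
    holds_isC hi, holds_isQ hi, holds_isQ hj, holds_isX hj]
  cases hw : view w with
  | X a b =>
    obtain ⟨-, ha, hb⟩ := view_eq_X.1 hw
    rw [← hj] at ha hb
    have ha' := (eval_dig₂ (A := A) (v := v) j).trans ha
    have hb' := (eval_dig₃ (A := A) (v := v) j).trans hb
    have ha'' : ∀ i, (dig₂ (j + 1)).eval A.code (push i v) = a := fun i => by
      rw [eval_dig₂]; exact ha
    have hb'' : ∀ i, (dig₃ (j + 1)).eval A.code (push i v) = b := fun i => by
      rw [eval_dig₃]; exact hb
    cases hu : view u with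
    | T c =>
      obtain ⟨-, -, hc⟩ := view_eq_T.1 hu
      rw [← hi] at hc
      have hc' := (eval_dig₂ (A := A) (v := v) i).trans hc
      have hc'' : ∀ k, (dig₂ (i + 1)).eval A.code (push k v) = c := fun k => by
        rw [eval_dig₂]; exact hc
      rw [holds_sameE hc'' ha'', holds_adjE hc' ha', ha', hb', hc']
      by_cases hab : a = b <;> simp [Arc, hab, ← Fin.ext_iff]
    | S c =>
      obtain ⟨-, -, hc⟩ := view_eq_S.1 hu
      rw [← hi] at hc
      have hc' := (eval_dig₂ (A := A) (v := v) i).trans hc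
      have hc'' : ∀ k, (dig₂ (i + 1)).eval A.code (push k v) = c := fun k => by
        rw [eval_dig₂]; exact hc
      rw [holds_sameE hc'' hb'', ha', hb', hc']
      simp [Arc, ← Fin.ext_iff]
    | C c =>
      obtain ⟨-, hc, hd⟩ := view_eq_C.1 hu
      rw [← hi] at hc hd
      rw [holds_adjE ha' hb', ha', hb', eval_dig₂, eval_dig₃, hc, hd]
      simp [Arc, Hits]
    | q =>
      rw [holds_sameE ha'' hb'']
      simp [Arc]
    | _ => simp [Arc]
  | _ => cases hu : view u <;> simp [Arc]

/-- The range tests multiply the incidence bit: for an index out of range, `partE` would read an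
unrelated bit, and the factor `0` removes it. -/
lemma holds_newPartE {u i : ℕ} (hu : u < size A.n) (hi : i < 2 * A.k + 2) :
    Holds A.code newPartE (push i (push u v)) ↔ newPart A ⟨u, hu⟩ = ⟨i, hi⟩ := by
  have h1 : push i (push u v) 1 = (⟨u, hu⟩ : Fin (size A.n)) := rfl
  simp only [newPartE, holds_or, holds_and, holds_not, holds_eq, holds_lt, holds_isT h1,
    holds_isS h1, holds_isC h1, eval_eAdd, eval_kE, Expr.eval, push_zero, newPart, Fin.mk.injEq]
  cases hw : view (⟨u, hu⟩ : Fin (size A.n)) with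
  | T a =>
    have ha := (eval_dig₂ (A := A) (v := push i (push u v)) 1).trans (view_eq_T.1 hw).2.2
    simp only [partIdx]
    by_cases hik : i < A.k
    · rw [holds_partE (i' := ⟨i, hik⟩) ha rfl]
      simp [hik, Fin.ext_iff]
    · have := (A.part a).2
      simp [hik]; omega
  | S a =>
    have ha := (eval_dig₂ (A := A) (v := push i (push u v)) 1).trans (view_eq_S.1 hw).2.2
    simp only [partIdx]
    by_cases hik : ¬ i < A.k ∧ i < A.k + A.k
    · rw [holds_partE (a := dig₂ 1) (i := eSub (.var 0) kE) (i' := ⟨i - A.k, by omega⟩) ha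
        (by rw [eval_eSub, eval_kE]; rfl)]
      simp [hik, Fin.ext_iff]; omega
    · have := (A.part a).2
      constructor
      · rintro (h | h | h | h)
        · simp at h
        · exact absurd ⟨h.2.1, h.2.2.1⟩ hik
        · simp at h
        · simp at h
      · omega
  | C c => simp [partIdx]; omega
  | _ => simp [partIdx]; omega

lemma holds_placeE {D : Finset (Fin A.n)} {p e : Expr} {P : ℕ} {c : Fin (A.n + 2)}
    (hp : ∀ v, p.eval A.code v = P) (hP : ∀ a : Fin A.n, bitAt A.code (P + a) ≠ 0 ↔ a ∈ D)
    (he : ∀ v, e.eval A.code v = c) {u : ℕ} (hu : u < size A.n) :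
    Holds A.code (placeE p e) (push u v) ↔
      (⟨u, hu⟩ : Fin (size A.n)) ∈ place D D (⟨A.n, by omega⟩, c) := by
  have h0 : push u v 0 = (⟨u, hu⟩ : Fin (size A.n)) := rfl
  have hr : ∀ a : Fin A.n, (dig₂ 0).eval A.code (push u v) = a →
      (Holds A.code (.read (eAdd p (dig₂ 0))) (push u v) ↔ a ∈ D) := fun a ha => by
    rw [← hP, Holds, Expr.eval, eval_eAdd, hp, ha]
  rw [mem_place]
  simp only [placeE, holds_or, holds_and, holds_eq, holds_isT h0, holds_isS h0, holds_isC h0,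
    holds_isQ h0, eval_nE, he]
  cases hw : view (⟨u, hu⟩ : Fin (size A.n)) with
  | T a =>
    rw [hr a ((eval_dig₂ (A := A) (v := push u v) 0).trans (view_eq_T.1 hw).2.2)]
    simp [Occupied]
  | S a =>
    rw [hr a ((eval_dig₂ (A := A) (v := push u v) 0).trans (view_eq_S.1 hw).2.2)]
    simp [Occupied]
  | C d =>
    rw [(eval_dig₂ (A := A) (v := push u v) 0).trans (view_eq_C.1 hw).2.1,
      (eval_dig₃ (A := A) (v := push u v) 0).trans (view_eq_C.1 hw).2.2]
    simp [Occupied, Prod.ext_iff, Fin.ext_iff]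
  | _ => simp [Occupied]

/-- The code and the generator consist of the same eight blocks, which are compared one by one. -/
theorem code_reduction : (reduction A).code = codeGen.out A.code fun _ => 0 := by
  have bit : ∀ {P : Prop} {_ : Decidable P} {a : Expr} {v : ℕ → ℕ}, (Holds A.code a v ↔ P) →
      [decide P] = (Gen.bit a).out A.code v := fun h => by
    simp only [Gen.out, List.cons.injEq, and_true, decide_eq_decide]
    exact h.symm
  have app : ∀ {l₁ l₂ : List Bool} {g h : Gen}, l₁ = g.out A.code (fun _ => 0) →
      l₂ = h.out A.code (fun _ => 0) → l₁ ++ l₂ = (Gen.seq g h).out A.code fun _ => 0 :=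
    fun h₁ h₂ => by rw [h₁, h₂]; rfl
  unfold PartitionedDSInstance.code codeGen
  refine app (app (app (app (app (app (app ?_ rfl) ?_) rfl) ?_) ?_) ?_) ?_
  · rw [replicate_eq_flatMap, Gen.out, eval_sizeE]; rfl
  · rw [replicate_eq_flatMap, Gen.out, eval_newKE]; rfl
  · rw [Gen.out, eval_sizeE]
    refine flatMap_finRange_eq fun u => ?_
    rw [Gen.out, eval_sizeE]
    refine map_finRange_eq fun w => bit ?_
    rw [holds_or, holds_arcE (u := u) (w := w) rfl rfl, holds_arcE (u := w) (w := u) rfl rfl]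
    rfl
  · rw [Gen.out, eval_sizeE]
    refine flatMap_finRange_eq fun u => ?_
    rw [Gen.out, eval_newKE]
    exact map_finRange_eq fun w => bit (holds_newPartE u.2 w.2)
  · rw [Gen.out, eval_sizeE]
    exact map_finRange_eq fun u => bit (holds_placeE (fun _ => eval_initPosE) (init_bit A)
      (fun _ => eval_nE) u.2)
  · rw [Gen.out, eval_sizeE]
    exact map_finRange_eq fun u => bit (holds_placeE (fun _ => eval_finPosE) (fin_bit A)
      (c := ⟨A.n + 1, by omega⟩) (fun _ => by rw [eval_eAdd, eval_nE]; rfl) u.2)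

end Correctness

/-! ### The pl-reduction and the lengths of shortest sequences -/

theorem isPLReduction_reduction :
    IsPLReduction (PartitionedDSR .TS) (PartitionedDSR .TJ) reduction where
  yes_iff A := ⟨fun ⟨_, h⟩ => ⟨_, hasSeq_reduction h⟩, fun ⟨_, h⟩ =>
    let ⟨ℓ, h', _⟩ := hasSeq_of_reduction h
    ⟨ℓ, h'⟩⟩
  param_le := ⟨fun k => 2 * k + 2,
    (Primrec.nat_add.comp (Primrec.nat_mul.comp (Primrec.const 2) Primrec.id)
      (Primrec.const 2)).to_comp, fun _ => le_rfl⟩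
  space := by
    obtain ⟨r, p, C, h⟩ := codeGen.outputs
    -- The space is logarithmic regardless of the parameter, so a constant `h` is enough.
    refine ⟨r, p, fun _ => 1, C, Computable.const 1, fun (A : PartitionedDSInstance) => ?_⟩
    have h' := h A.code
    rw [← code_reduction] at h'
    exact h'

end SlideToJump

theorem mainTheorem8 :
    ∃ f : PartitionedDSInstance → PartitionedDSInstance,
      IsPLReduction (PartitionedDSR .TS) (PartitionedDSR .TJ) f ∧
      ∀ (A : PartitionedDSInstance) (ℓ : ℕ),
        ((∃ m ≤ ℓ, A.HasSeq .TS m) ↔ ∃ m ≤ 3 * ℓ + 1, (f A).HasSeq .TJ m) ∧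
        (A.HasSeq .TS ℓ → (f A).HasSeq .TJ (3 * ℓ + 1)) ∧
        (IsLeast {m | A.HasSeq .TS m} ℓ ↔
          IsLeast {m | (f A).HasSeq .TJ m} (3 * ℓ + 1)) := by
  refine ⟨SlideToJump.reduction, SlideToJump.isPLReduction_reduction, fun A ℓ => ⟨⟨?_, ?_⟩,
    SlideToJump.hasSeq_reduction, ⟨?_, ?_⟩⟩⟩
  · rintro ⟨m, hm, h⟩
    exact ⟨3 * m + 1, by omega, SlideToJump.hasSeq_reduction h⟩
  · rintro ⟨m, hm, h⟩
    obtain ⟨ℓ', h', hle⟩ := SlideToJump.hasSeq_of_reduction h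
    exact ⟨ℓ', by omega, h'⟩
  · rintro ⟨h, hmin⟩
    refine ⟨SlideToJump.hasSeq_reduction h, fun m hm => ?_⟩
    obtain ⟨ℓ', h', hle⟩ := SlideToJump.hasSeq_of_reduction hm
    have := hmin h'
    omega
  · rintro ⟨h, hmin⟩
    obtain ⟨ℓ', h', hle⟩ := SlideToJump.hasSeq_of_reduction h
    -- A sliding sequence with fewer than `ℓ` moves would give a jumping sequence with fewer than `3
    -- * ℓ + 1`.
    have hlow : ∀ m, A.HasSeq .TS m → ℓ ≤ m := fun m hm => by
      have := hmin (SlideToJump.hasSeq_reduction hm)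
      omega
    obtain rfl : ℓ' = ℓ := le_antisymm (by omega) (hlow _ h')
    exact ⟨h', hlow⟩
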